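/- **Theorem (quantum $t$ test).** Let $n\ge 1$ be an integer and $\alpha\in(0,1)$. Let $\mathcal H$ be the single-mode bosonic system, a Hilbert space with orthonormal number basis $\{|k\rangle\}_{k\in\mathbb Z_{\ge 0}}$ (realised as $\ell^2(\mathbb Z_{\ge0})$; equivalently $L^2(\mathbb R)$ with the Hermite functions). For $\xi\in\mathbb C$ let $|\xi)=e^{-|\xi|^2/2}\sum_{k\ge 0}\frac{\xi^k}{\sqrt{k!}}|k\rangle$, and for $\theta\in\mathbb C$, $N>0$ let $$\rho_{\theta,N}=\frac1{\pi N}\int_{\mathbb C}|\xi)(\xi|\,e^{-|\theta-\xi|^2/N}\,d\xi$$ be the quantum Gaussian state. On $\mathcal H^{\otimes(n+1)}$ consider the hypothesis testing problem $$H_0: r=0\quad\text{vs.}\quad H_1: r>0\qquad\text{with}\qquad \{\rho_{re^{it},N}\otimes\rho_{0,N}^{\otimes n}\}_{r\ge 0,\ e^{it}\in S^1,\ N>0},$$ with disturbance parameter $(e^{it},N)\in S^1\times\mathbb R_{>0}$. A test is an operator $0\le T\le I$; its type II error probability at $\rho$ is $\beta_T(\rho)=1-\mathrm{Tr}\,\rho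 T$. It has level $\alpha$ if $\mathrm{Tr}\,\rho T\le\alpha$ for every state $\rho$ of $H_0$, and a test of level $\alpha$ is unbiased if $\beta_T(\rho)\le 1-\alpha$ for every state $\rho$ of $H_1$. An unbiased test $T_0$ of level $\alpha$ is called a UMP unbiased min-max test with level $\alpha$ if for every $r>0$ $$\sup_{e^{it},N}\beta_{T_0}(\rho_{re^{it},N}\otimes\rho_{0,N}^{\otimes n})=\inf_{T}\ \sup_{e^{it},N}\beta_{T}(\rho_{re^{it},N}\otimes\rho_{0,N}^{\otimes n}),$$ where $T$ runs over all unbiased tests of level $\alpha$. Then there is exactly one pair of functions $c:\mathbb Z_{\ge0}\to\mathbb Z_{\ge0}$ and $\gamma:\mathbb Z_{\ge0}\to(0,1]$ such that for every $s\in\mathbb Z_{\ge 0}$ $$\sum_{l=c(s)+1}^{s}\binom{s-l+n-1}{n-1}<\alpha\binom{s+n}{n}\le\sum_{l=c(s)}^{s}\binom{s-l+n-1}{n-1},$$ $$\gamma(s)=\frac{\alpha\binom{s+n}{n}-\sum_{l=c(s)+1}^{s}\binom{s-l+n-1}{n-1}}{\binom{s-c(s)+n-1}{n-1}}.$$ With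 these functions and $s(k)=\sum_{j=0}^n k_j$, the test $$T_\alpha^{[\mathrm t],n}=\sum_{k=(k_0,\dots,k_n)\in\mathbb Z_{\ge0}^{n+1}}\varphi(k)\,|k\rangle\langle k|,\qquad \varphi(k)=\begin{cases}0&(k_0<c(s(k)))\\ \gamma(s(k))&(k_0=c(s(k)))\\ 1&(k_0>c(s(k)))\end{cases}$$ is a UMP unbiased min-max test with level $\alpha$ for this problem. -/

import Mathlib

open scoped NNReal ENNReal InnerProductSpace
open MeasureTheory

namespace QuantumTest

noncomputable section

/-! ### Hilbert spaces in the number representation -/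

/-- The Hilbert space with orthonormal basis `|i⟩`, `i : ι`.  For `ι = ℕ` this is the single-mode
bosonic system in the number basis `|0⟩, |1⟩, …` (in the position representation `L²(ℝ)` the vector
`|k⟩` is the `k`-th Hermite function); for `ι = Fin m → ℕ` it is the `m`-mode bosonic system, the
Hilbert tensor product of `m` single-mode systems, with the number basis
`|k₀, …, k_{m-1}⟩ = |k₀⟩ ⊗ ⋯ ⊗ |k_{m-1}⟩`. -/
abbrev Fock (ι : Type*) : Type _ := lp (fun _ : ι => ℂ) 2

/-- Bounded operators. -/
abbrev Op (ι : Type*) : Type _ := Fock ι →L[ℂ] Fock ι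

/-- The basis vector `|i⟩`. -/
def ket {ι : Type*} [DecidableEq ι] (i : ι) : Fock ι := lp.single 2 i (1 : ℂ)

/-- The trace `Tr A = ∑ᵢ ⟨i|A|i⟩` (of a trace class operator). -/
def trace {ι : Type*} [DecidableEq ι] (A : Op ι) : ℂ := ∑' i, ⟪ket i, A (ket i)⟫_ℂ

theorem memFock_iff {ι : Type*} {f : ι → ℂ} :
    Memℓp f 2 ↔ Summable fun i => ‖f i‖ ^ 2 := by
  rw [memℓp_gen_iff (by norm_num)]
  norm_num

theorem Fock.summable {ι : Type*} (ψ : Fock ι) : Summable fun i => ‖ψ i‖ ^ 2 :=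
  memFock_iff.1 ψ.2

theorem Fock.norm_sq {ι : Type*} (ψ : Fock ι) : ‖ψ‖ ^ 2 = ∑' i, ‖ψ i‖ ^ 2 := by
  have h := lp.norm_rpow_eq_tsum (p := 2) (by norm_num) ψ
  norm_num at h
  exact h

/-- The operator `∑ᵢ φ(i) |i⟩⟨i|` for a test function `φ` with values in `[0, 1]`. -/
def diagOp {ι : Type*} (φ : ι → unitInterval) : Op ι :=
  LinearMap.mkContinuous
    { toFun := fun ψ => ⟨fun i => ((φ i : ℝ) : ℂ) * ψ i, memFock_iff.2 <| by
        refine Summable.of_nonneg_of_le (fun i => by positivity) (fun i => ?_) ψ.summable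
        rw [norm_mul, Complex.norm_real, Real.norm_of_nonneg (φ i).2.1]
        exact pow_le_pow_left₀ (mul_nonneg (φ i).2.1 (norm_nonneg _))
          (mul_le_of_le_one_left (norm_nonneg _) (φ i).2.2) 2⟩
      map_add' := fun ψ χ => by
        ext i
        exact mul_add _ _ _
      map_smul' := fun a ψ => by
        ext i
        exact mul_left_comm _ _ _ }
    1 (fun ψ => by
      refine (sq_le_sq₀ (norm_nonneg _) (by positivity)).1 ?_
      rw [one_mul, Fock.norm_sq, Fock.norm_sq]
      refine Summable.tsum_le_tsum (fun i => ?_) (Fock.summable _) (Fock.summable _)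
      change ‖((φ i : ℝ) : ℂ) * ψ i‖ ^ 2 ≤ _
      rw [norm_mul, Complex.norm_real, Real.norm_of_nonneg (φ i).2.1]
      exact pow_le_pow_left₀ (mul_nonneg (φ i).2.1 (norm_nonneg _))
        (mul_le_of_le_one_left (norm_nonneg _) (φ i).2.2) 2)

/-! ### Tensor products of operators -/

/-- For `ψ` in an `m`-mode system, the single-mode vector `l ↦ ψ(k₀, …, l, …, k_{m-1})`, with `l` in
place `j`. -/
def fiber {m : ℕ} (j : Fin m) (k : Fin m → ℕ) : Fock (Fin m → ℕ) →ₗ[ℂ] Fock ℕ where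
  toFun ψ := ⟨fun l => ψ (Function.update k j l), memFock_iff.2 <|
    ψ.summable.comp_injective (Function.update_injective k j)⟩
  map_add' _ _ := rfl
  map_smul' _ _ := rfl

theorem fiber_apply {m : ℕ} (j : Fin m) (k : Fin m → ℕ) (ψ : Fock (Fin m → ℕ)) (l : ℕ) :
    fiber j k ψ l = ψ (Function.update k j l) := rfl

theorem ampliation_aux {m : ℕ} (j : Fin m) (A : Op ℕ) (ψ : Fock (Fin m → ℕ)) :
    Summable (fun k : Fin m → ℕ => ‖A (fiber j k ψ) (k j)‖ ^ 2) ∧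
      ∑' k : Fin m → ℕ, ‖A (fiber j k ψ) (k j)‖ ^ 2 ≤ (‖A‖ * ‖ψ‖) ^ 2 := by
  let e : ({i // i ≠ j} → ℕ) × ℕ ≃ (Fin m → ℕ) :=
    (Equiv.prodComm _ _).trans (Equiv.funSplitAt j ℕ).symm
  have e_same : ∀ p, e p j = p.2 := fun p => by simp [e, Equiv.funSplitAt, Equiv.piSplitAt]
  have e_upd : ∀ (q : {i // i ≠ j} → ℕ) (a l : ℕ),
      Function.update (e (q, a)) j l = e (q, l) := fun q a l => by
    funext i
    by_cases h : i = j
    · subst h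
      simp [e_same]
    · simp [h, e, Equiv.funSplitAt, Equiv.piSplitAt]
  let F : ({i // i ≠ j} → ℕ) → Fock ℕ := fun q => fiber j (e (q, 0)) ψ
  have hF : ∀ q a, fiber j (e (q, a)) ψ = F q := fun q a => by
    ext l
    simp only [F, fiber_apply, e_upd]
  have hFl : ∀ q l, F q l = ψ (e (q, l)) := fun q l => by
    simp only [F, fiber_apply, e_upd]
  have hψ : Summable fun p : ({i // i ≠ j} → ℕ) × ℕ => ‖ψ (e p)‖ ^ 2 :=
    e.summable_iff.2 ψ.summable
  have hFn : ∀ q, ‖F q‖ ^ 2 = ∑' l, ‖ψ (e (q, l))‖ ^ 2 := fun q => by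
    rw [Fock.norm_sq]
    simp only [hFl]
  have hψ2 : Summable fun q => ‖F q‖ ^ 2 := by
    simp only [hFn]
    exact ((summable_prod_of_nonneg (fun p => by positivity)).1 hψ).2
  have hψn : ‖ψ‖ ^ 2 = ∑' q, ‖F q‖ ^ 2 := by
    rw [Fock.norm_sq, ← e.tsum_eq, hψ.tsum_prod]
    simp only [hFn]
  have hle : ∀ q, ‖A (F q)‖ ^ 2 ≤ ‖A‖ ^ 2 * ‖F q‖ ^ 2 := fun q => by
    rw [← mul_pow]
    exact pow_le_pow_left₀ (norm_nonneg _) (A.le_opNorm _) 2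
  have hA : Summable fun q => ‖A (F q)‖ ^ 2 :=
    Summable.of_nonneg_of_le (fun q => by positivity) hle (hψ2.mul_left _)
  have hg : ∀ p, ‖A (fiber j (e p) ψ) (e p j)‖ ^ 2 = ‖A (F p.1) p.2‖ ^ 2 := fun p => by
    rw [e_same, hF p.1 p.2]
  have hs : Summable fun p : ({i // i ≠ j} → ℕ) × ℕ => ‖A (F p.1) p.2‖ ^ 2 := by
    refine (summable_prod_of_nonneg (fun p => by positivity)).2 ⟨fun q => (A (F q)).summable, ?_⟩
    simpa only [Fock.norm_sq (A (F _))] using hA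
  constructor
  · rw [← e.summable_iff]
    exact hs.congr fun p => (hg p).symm
  · rw [← e.tsum_eq]
    simp only [hg]
    rw [hs.tsum_prod, mul_pow, hψn, ← tsum_mul_left]
    simp only [← Fock.norm_sq (A (F _))]
    exact hA.tsum_le_tsum hle (hψ2.mul_left _)

/-- The operator `I ⊗ ⋯ ⊗ A ⊗ ⋯ ⊗ I` with `A` acting on mode `j`. -/
def ampliation {m : ℕ} (j : Fin m) (A : Op ℕ) : Op (Fin m → ℕ) :=
  LinearMap.mkContinuous
    { toFun := fun ψ => ⟨fun k => A (fiber j k ψ) (k j), memFock_iff.2 (ampliation_aux j A ψ).1⟩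
      map_add' := fun ψ χ => by
        ext k
        simp only [map_add]
        rfl
      map_smul' := fun a ψ => by
        ext k
        simp }
    ‖A‖ (fun ψ => by
      refine (sq_le_sq₀ (norm_nonneg _) (by positivity)).1 ?_
      rw [Fock.norm_sq]
      exact (ampliation_aux j A ψ).2)

/-- The tensor product `A₀ ⊗ ⋯ ⊗ A_{m-1}`, as the product of the (commuting) operators
`I ⊗ ⋯ ⊗ A_j ⊗ ⋯ ⊗ I`. -/
def tensorOp {m : ℕ} (A : Fin m → Op ℕ) : Op (Fin m → ℕ) :=
  (List.ofFn fun j => ampliation j (A j)).prod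

/-! ### Quantum Gaussian states -/

theorem coherent_aux (ξ : ℂ) : Summable fun k : ℕ =>
    ‖(Real.exp (-‖ξ‖ ^ 2 / 2) : ℂ) * (ξ ^ k / (Real.sqrt (k.factorial : ℝ) : ℂ))‖ ^ 2 := by
  have h := (Real.summable_pow_div_factorial (‖ξ‖ ^ 2)).mul_left (Real.exp (-‖ξ‖ ^ 2 / 2) ^ 2)
  refine h.congr fun k => ?_
  rw [norm_mul, mul_pow, norm_div, div_pow, norm_pow, Complex.norm_real, Complex.norm_real,
    Real.norm_of_nonneg (Real.exp_pos _).le, Real.norm_of_nonneg (Real.sqrt_nonneg _),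
    Real.sq_sqrt (Nat.cast_nonneg _), ← pow_mul, ← pow_mul, mul_comm k 2]

/-- The coherent vector `|ξ) = e^{-|ξ|²/2} ∑ₖ ξᵏ/√(k!) |k⟩`. -/
def coherent (ξ : ℂ) : Fock ℕ :=
  ⟨fun k => (Real.exp (-‖ξ‖ ^ 2 / 2) : ℂ) * (ξ ^ k / (Real.sqrt (k.factorial : ℝ) : ℂ)),
    memFock_iff.2 (coherent_aux ξ)⟩

/-- The quantum Gaussian state `ρ_{θ,N} = (πN)⁻¹ ∫ |ξ)(ξ| e^{-|θ-ξ|²/N} dξ`. -/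
def gaussianState (θ : ℂ) (N : ℝ) : Op ℕ :=
  (1 / (Real.pi * N)) •
    ∫ ξ : ℂ, Real.exp (-‖θ - ξ‖ ^ 2 / N) • InnerProductSpace.rankOne ℂ (coherent ξ) (coherent ξ)

/-! ### Hypothesis testing with a disturbance parameter -/

section Testing

variable {ι Θ Ξ : Type*} [DecidableEq ι]

/-- A test is an operator `0 ≤ T ≤ I`. -/
def IsTest (T : Op ι) : Prop := 0 ≤ T ∧ T ≤ 1

/-- The probability `Tr ρT` of supporting the alternative hypothesis. -/
def rejectProb (ρ T : Op ι) : ℝ := (trace (ρ ∘L T)).re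

/-- The type II error probability `β_T(ρ) = 1 - Tr ρT`. -/
def typeIIError (ρ T : Op ι) : ℝ := 1 - rejectProb ρ T

/-- `T` is a test with level `α` for `H₀ : θ ∈ Θ₀` with the family `ρ θ ξ`. -/
def IsLevel (ρ : Θ → Ξ → Op ι) (Θ₀ : Set Θ) (α : ℝ) (T : Op ι) : Prop :=
  IsTest T ∧ ∀ θ ∈ Θ₀, ∀ ξ, rejectProb (ρ θ ξ) T ≤ α

/-- `T` is an unbiased test with level `α` for `H₀ : θ ∈ Θ₀` vs. `H₁ : θ ∈ Θ₁`. -/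
def IsUnbiased (ρ : Θ → Ξ → Op ι) (Θ₀ Θ₁ : Set Θ) (α : ℝ) (T : Op ι) : Prop :=
  IsLevel ρ Θ₀ α T ∧ ∀ θ ∈ Θ₁, ∀ ξ, typeIIError (ρ θ ξ) T ≤ 1 - α

/-- The largest type II error probability over the disturbance parameter (in the extended reals,
where every supremum and infimum exists). -/
def worstTypeIIError (ρ : Θ → Ξ → Op ι) (θ : Θ) (T : Op ι) : EReal :=
  ⨆ ξ, (typeIIError (ρ θ ξ) T : EReal)

/-- `T` is a UMP unbiased min-max test with level `α` for `H₀ : θ ∈ Θ₀` vs. `H₁ : θ ∈ Θ₁`, with the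
disturbance parameter `ξ : Ξ`. -/
def IsUMPUnbiasedMinMax (ρ : Θ → Ξ → Op ι) (Θ₀ Θ₁ : Set Θ) (α : ℝ) (T : Op ι) : Prop :=
  IsUnbiased ρ Θ₀ Θ₁ α T ∧
    ∀ θ ∈ Θ₁, worstTypeIIError ρ θ T =
      ⨅ T' ∈ {T' : Op ι | IsUnbiased ρ Θ₀ Θ₁ α T'}, worstTypeIIError ρ θ T'

end Testing

/-! ### The quantum `t` test -/

/-- The family `ρ_{r e^{it}, N} ⊗ ρ_{0,N}^{⊗ n}`, with parameter `r ≥ 0` and disturbance parameter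
`(e^{it}, N) ∈ S¹ × ℝ_{>0}`. -/
def tFamily (n : ℕ) (r : ℝ≥0) (ξ : Circle × Set.Ioi (0 : ℝ)) : Op (Fin (n + 1) → ℕ) :=
  tensorOp (Fin.cons (gaussianState ((r : ℝ) * (ξ.1 : ℂ)) ξ.2) fun _ => gaussianState 0 ξ.2)

/-- The condition that determines the threshold `c(s)` and the randomization `γ(s)` for each total
count `s`. -/
def IsTThreshold (n : ℕ) (α : ℝ) (c : ℕ → ℕ) (γ : ℕ → Set.Ioc (0 : ℝ) 1) : Prop :=
  ∀ s : ℕ,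
    (∑ l ∈ Finset.Icc (c s + 1) s, ((s - l + n - 1).choose (n - 1) : ℝ)) <
        α * ((s + n).choose n : ℝ) ∧
    α * ((s + n).choose n : ℝ) ≤
        ∑ l ∈ Finset.Icc (c s) s, ((s - l + n - 1).choose (n - 1) : ℝ) ∧
    (γ s : ℝ) =
      (α * ((s + n).choose n : ℝ) -
          ∑ l ∈ Finset.Icc (c s + 1) s, ((s - l + n - 1).choose (n - 1) : ℝ)) /
        ((s - c s + n - 1).choose (n - 1) : ℝ)

/-- The total count `s(k) = k₀ + ⋯ + k_n`. -/
def totalCount {n : ℕ} (k : Fin (n + 1) → ℕ) : ℕ := ∑ j, k j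

/-- The test function: `0`, `γ(s(k))` or `1` according as `k₀ < c(s(k))`, `k₀ = c(s(k))` or
`k₀ > c(s(k))`. -/
def tTestFun {n : ℕ} (c : ℕ → ℕ) (γ : ℕ → Set.Ioc (0 : ℝ) 1) (k : Fin (n + 1) → ℕ) :
    unitInterval :=
  if k 0 < c (totalCount k) then 0
  else if k 0 = c (totalCount k) then
    ⟨γ (totalCount k), (γ (totalCount k)).2.1.le, (γ (totalCount k)).2.2⟩
  else 1

/-- The quantum `t` test `∑ₖ φ(k) |k⟩⟨k|`. -/
def tTest (n : ℕ) (c : ℕ → ℕ) (γ : ℕ → Set.Ioc (0 : ℝ) 1) : Op (Fin (n + 1) → ℕ) :=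
  diagOp (tTestFun c γ)

end

end QuantumTest

namespace QuantumTest

noncomputable section

open ComplexConjugate Filter Topology

/-! ### Coherent vectors -/

/-! The worst phase is at least as bad as the average phase. Averaging `ρ_{re^{it},N}` over `t`
removes its off-diagonal entries in the number basis, so only the diagonal `τ(k) = ⟨k|T|k⟩` of a
competitor matters (`exists_rejectProb_le_meanReject`). The `t` test is itself diagonal, hence its
error does not depend on the phase, and the problem becomes classical.

In the classical problem put `q = N/(N+1)`. The thermal modes are geometric with ratio `q`, and the
first mode has the same geometric law times a likelihood ratio `L(k₀)`. A multi-index of total `s`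
therefore has weight `(1-q)^{n+1} q^s L(k₀)` (`thermalWeight_mul_photonProb`). Under the hypothesis
`L = 1` and the total is a sufficient statistic.

Letting `r → 0`, unbiasedness forces size exactly `α` for every `N`
(`meanReject_zero_of_isUnbiased`). This is an identity of power series in `q`, so the sum of `τ` on
each fiber of the total is `α` times the number of its points (`sum_countFiber_eq_of_tsum_eq`). On a
fiber, with this sum fixed, the Neyman–Pearson argument favours large `L(k₀)`. As `L` is increasing
for all `r` and `N` (`likelihoodRatio_monotone`), one threshold in `k₀` is optimal for all of them
at once. -/

theorem coherent_apply (ξ : ℂ) (k : ℕ) : coherent ξ k =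
    (Real.exp (-‖ξ‖ ^ 2 / 2) : ℂ) * (ξ ^ k / (Real.sqrt (k.factorial : ℝ) : ℂ)) := rfl

theorem ofReal_sqrt_factorial_mul_self (k : ℕ) :
    ((Real.sqrt (k.factorial : ℝ) : ℝ) : ℂ) * ((Real.sqrt (k.factorial : ℝ) : ℝ) : ℂ) =
      (k.factorial : ℂ) := by
  rw [← Complex.ofReal_mul, Real.mul_self_sqrt (Nat.cast_nonneg _), Complex.ofReal_natCast]

theorem inner_coherent (ξ η : ℂ) : ⟪coherent ξ, coherent η⟫_ℂ =
    (Real.exp (-‖ξ‖ ^ 2 / 2) : ℂ) * (Real.exp (-‖η‖ ^ 2 / 2) : ℂ) * Complex.exp (η * conj ξ) := by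
  rw [lp.inner_eq_tsum, Complex.exp_eq_exp_ℂ]
  refine (((NormedSpace.expSeries_div_hasSum_exp (η * conj ξ)).mul_left _).congr_fun ?_).tsum_eq
  intro k
  rw [RCLike.inner_apply, coherent_apply, coherent_apply, ← ofReal_sqrt_factorial_mul_self]
  simp only [map_mul, map_div₀, map_pow, Complex.conj_ofReal, mul_pow]
  ring

theorem norm_coherent (ξ : ℂ) : ‖coherent ξ‖ = 1 := by
  have h : ((‖coherent ξ‖ : ℂ)) ^ 2 = 1 := by
    have h0 := inner_self_eq_norm_sq_to_K (𝕜 := ℂ) (coherent ξ)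
    simp only [Complex.coe_algebraMap] at h0
    rw [← h0, inner_coherent, Complex.mul_conj,
      Complex.normSq_eq_norm_sq, ← Complex.ofReal_exp, ← Complex.ofReal_mul, ← Complex.ofReal_mul,
      ← Real.exp_add, ← Real.exp_add]
    norm_num
  have h' : ‖coherent ξ‖ ^ 2 = 1 := by exact_mod_cast h
  exact (pow_eq_one_iff_of_nonneg (norm_nonneg _) two_ne_zero).1 h'

/-- The vectors are unit vectors, so their distance is a function of the overlap, which is explicit
and continuous. -/
theorem continuous_coherent : Continuous coherent := by
  rw [continuous_iff_continuousAt]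
  intro η
  rw [ContinuousAt, tendsto_iff_norm_sub_tendsto_zero]
  have key : ∀ ξ, ‖coherent ξ - coherent η‖ = √(2 - 2 * (⟪coherent ξ, coherent η⟫_ℂ).re) := by
    intro ξ
    rw [← Real.sqrt_sq (norm_nonneg (coherent ξ - coherent η)), @norm_sub_sq ℂ, norm_coherent,
      norm_coherent]
    congr 1
    simp
    ring
  have hc : Continuous fun ξ => √(2 - 2 * (⟪coherent ξ, coherent η⟫_ℂ).re) := by
    simp only [inner_coherent]
    fun_prop
  have h0 : √(2 - 2 * (⟪coherent η, coherent η⟫_ℂ).re) = 0 := by rw [← key]; simp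
  simp only [key]
  rw [← h0]
  exact hc.tendsto η

theorem continuous_coherent_apply (k : ℕ) : Continuous fun ξ => coherent ξ k := by
  simp only [coherent_apply]
  fun_prop

theorem coherent_mul (w : Circle) (ξ : ℂ) (k : ℕ) :
    coherent ((w : ℂ) * ξ) k = (w : ℂ) ^ k * coherent ξ k := by
  simp only [coherent_apply, norm_mul, Circle.norm_coe, one_mul, mul_pow]
  ring

theorem norm_coherent_apply_sq (ξ : ℂ) (k : ℕ) :
    ‖coherent ξ k‖ ^ 2 = Real.exp (-‖ξ‖ ^ 2) * ((‖ξ‖ ^ 2) ^ k / k.factorial) := by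
  rw [coherent_apply, norm_mul, mul_pow, norm_div, div_pow, norm_pow, Complex.norm_real,
    Complex.norm_real, Real.norm_of_nonneg (Real.exp_pos _).le,
    Real.norm_of_nonneg (Real.sqrt_nonneg _), Real.sq_sqrt (Nat.cast_nonneg _), ← Real.exp_nat_mul,
    ← pow_mul, ← pow_mul, mul_comm k 2]
  congr 2
  push_cast
  ring

/-- This is `x^k/k! ≤ e^x` at `x = u²|ξ|²`. For `u > 1` it buys geometric decay in `k` at the price
of a growth in `ξ` that a Gaussian weight absorbs; `u = 1` gives the bound `1`. -/
theorem norm_coherent_apply_le {u : ℝ} (hu : 0 < u) (ξ : ℂ) (k : ℕ) :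
    ‖coherent ξ k‖ ≤ u⁻¹ ^ k * Real.exp ((u ^ 2 - 1) * ‖ξ‖ ^ 2 / 2) := by
  refine (sq_le_sq₀ (norm_nonneg _) (by positivity)).1 ?_
  have h := Real.pow_div_factorial_le_exp (u ^ 2 * ‖ξ‖ ^ 2) (by positivity) k
  rw [norm_coherent_apply_sq, mul_pow, ← Real.exp_nat_mul]
  calc _ = (u⁻¹ ^ k) ^ 2 * (Real.exp (-‖ξ‖ ^ 2) * ((u ^ 2 * ‖ξ‖ ^ 2) ^ k / k.factorial)) := by
        have hk : (u⁻¹ ^ k) ^ 2 * (u ^ 2) ^ k = 1 := by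
          rw [← pow_mul, mul_comm k 2, pow_mul, ← mul_pow, inv_pow, inv_mul_cancel₀ (by positivity),
            one_pow]
        rw [mul_pow (u ^ 2), mul_div_assoc, mul_left_comm (Real.exp _), ← mul_assoc, hk, one_mul]
    _ ≤ (u⁻¹ ^ k) ^ 2 * (Real.exp (-‖ξ‖ ^ 2) * Real.exp (u ^ 2 * ‖ξ‖ ^ 2)) := by gcongr
    _ = _ := by
        rw [← Real.exp_add]
        congr 2
        push_cast
        ring

/-! ### Gaussian integrals -/

theorem integrable_exp_neg_mul_sq_add {b : ℝ} (hb : 0 < b) (c : ℝ) (w : ℂ) :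
    Integrable fun ξ : ℂ => Real.exp (-b * ‖ξ‖ ^ 2 + c * ⟪w, ξ⟫_ℝ) := by
  have h := (GaussianFourier.integrable_cexp_neg_mul_sq_norm_add (b := (b : ℂ)) (V := ℂ)
    (by simpa using hb) (c : ℂ) w).norm
  refine h.congr (Eventually.of_forall fun ξ => ?_)
  simp only [Complex.norm_exp]
  congr 1
  norm_cast

theorem norm_sub_sq_div (θ ξ : ℂ) (N : ℝ) :
    -‖θ - ξ‖ ^ 2 / N = -‖θ‖ ^ 2 / N + (-N⁻¹ * ‖ξ‖ ^ 2 + 2 / N * ⟪θ, ξ⟫_ℝ) := by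
  rw [@norm_sub_sq ℝ]
  simp only [RCLike.re_to_real]
  ring

theorem integrable_gaussian_mul_exp {N δ : ℝ} (hδ : δ < N⁻¹) (θ : ℂ) :
    Integrable fun ξ : ℂ => Real.exp (-‖θ - ξ‖ ^ 2 / N) * Real.exp (δ * ‖ξ‖ ^ 2) := by
  refine ((integrable_exp_neg_mul_sq_add (sub_pos.2 hδ) (2 / N) θ).const_mul
    (Real.exp (-‖θ‖ ^ 2 / N))).congr (Eventually.of_forall fun ξ => ?_)
  simp only [norm_sub_sq_div θ ξ N, ← Real.exp_add]
  congr 1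
  ring

theorem integrable_gaussian {N : ℝ} (hN : 0 < N) (θ : ℂ) :
    Integrable fun ξ : ℂ => Real.exp (-‖θ - ξ‖ ^ 2 / N) := by
  simpa using integrable_gaussian_mul_exp (δ := 0) (inv_pos.2 hN) θ

theorem integral_gaussian_complex {N : ℝ} (hN : 0 < N) (θ : ℂ) :
    ∫ ξ : ℂ, Real.exp (-‖θ - ξ‖ ^ 2 / N) = Real.pi * N := by
  have h := integral_sub_left_eq_self (fun ξ : ℂ => Real.exp (-‖ξ‖ ^ 2 / N)) volume θ
  rw [h]
  have h2 := GaussianFourier.integral_rexp_neg_mul_sq_norm (V := ℂ) (inv_pos.2 hN)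
  simp only [Complex.finrank_real_complex, Nat.cast_ofNat, div_self (two_ne_zero (α := ℝ)),
    Real.rpow_one, div_inv_eq_mul] at h2
  rw [← h2]
  congr 1
  funext ξ
  congr 1
  ring

/-! ### Matrix elements of Gaussian states -/

/-- The matrix element `⟨a|ρ_{θ,N}|l⟩`. -/
def gaussianMatrix (θ : ℂ) (N : ℝ) (a l : ℕ) : ℂ :=
  (1 / (Real.pi * N)) •
    ∫ ξ : ℂ, Real.exp (-‖θ - ξ‖ ^ 2 / N) • (coherent ξ a * conj (coherent ξ l))

theorem continuous_gaussian_smul_rankOne (θ : ℂ) (N : ℝ) : Continuous fun ξ : ℂ =>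
    Real.exp (-‖θ - ξ‖ ^ 2 / N) •
      InnerProductSpace.rankOne ℂ (coherent ξ) (coherent ξ) := by
  have h := continuous_coherent
  have h2 : Continuous fun ξ => InnerProductSpace.rankOne ℂ (coherent ξ) (coherent ξ) := by
    simp only [InnerProductSpace.rankOne_def]
    exact (ContinuousLinearMap.smulRightL ℂ (Fock ℕ) (Fock ℕ)).continuous₂.comp
      (((innerSL ℂ).continuous.comp h).prodMk h)
  have h3 : Continuous fun ξ : ℂ => Real.exp (-‖θ - ξ‖ ^ 2 / N) := by fun_prop
  exact h3.smul h2

theorem integrable_gaussian_smul_rankOne {N : ℝ} (hN : 0 < N) (θ : ℂ) : Integrable fun ξ : ℂ =>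
    Real.exp (-‖θ - ξ‖ ^ 2 / N) •
      InnerProductSpace.rankOne ℂ (coherent ξ) (coherent ξ) := by
  refine (integrable_gaussian hN θ).mono
    (continuous_gaussian_smul_rankOne θ N).aestronglyMeasurable (Eventually.of_forall fun ξ => ?_)
  rw [norm_smul, InnerProductSpace.norm_rankOne, norm_coherent]
  simp

theorem gaussianState_ket_apply {N : ℝ} (hN : 0 < N) (θ : ℂ) (a l : ℕ) :
    gaussianState θ N (ket l) a = gaussianMatrix θ N a l := by
  let L : Op ℕ →L[ℂ] ℂ :=
    (lp.evalCLM ℂ (fun _ : ℕ => ℂ) 2 a).comp (ContinuousLinearMap.apply ℂ (Fock ℕ) (ket l))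
  have hL : ∀ A : Op ℕ, L A = A (ket l) a := fun A => rfl
  have h := L.integral_comp_comm (integrable_gaussian_smul_rankOne hN θ)
  rw [gaussianState, smul_apply, lp.coeFn_smul, Pi.smul_apply, ← hL, ← h,
    gaussianMatrix]
  congr 2
  funext ξ
  rw [hL, smul_apply, lp.coeFn_smul, Pi.smul_apply,
    InnerProductSpace.rankOne_apply, lp.coeFn_smul, Pi.smul_apply, ket, lp.inner_single_right]
  simp [mul_comm]

theorem hasSum_gaussianState_apply {N : ℝ} (hN : 0 < N) (θ : ℂ) (χ : Fock ℕ) (a : ℕ) :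
    HasSum (fun l => gaussianMatrix θ N a l * χ l) (gaussianState θ N χ a) := by
  let L : Fock ℕ →L[ℂ] ℂ := (lp.evalCLM ℂ (fun _ : ℕ => ℂ) 2 a).comp (gaussianState θ N)
  have hL : ∀ φ : Fock ℕ, L φ = gaussianState θ N φ a := fun A => rfl
  have h := (lp.hasSum_single (p := 2) (by norm_num) χ).mapL L
  rw [← hL]
  refine h.congr_fun fun l => ?_
  have hs : (lp.single 2 l (χ l) : Fock ℕ) = χ l • ket l := by
    rw [ket, ← lp.single_smul]
    simp
  rw [hs, map_smul, hL, gaussianState_ket_apply hN, smul_eq_mul, mul_comm]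

theorem norm_gaussianMatrix_integrand (θ ξ : ℂ) (N : ℝ) (a l : ℕ) :
    ‖Real.exp (-‖θ - ξ‖ ^ 2 / N) • (coherent ξ a * conj (coherent ξ l))‖ =
      Real.exp (-‖θ - ξ‖ ^ 2 / N) * (‖coherent ξ a‖ * ‖coherent ξ l‖) := by
  rw [norm_smul, norm_mul, RCLike.norm_conj, Real.norm_of_nonneg (Real.exp_pos _).le]

/-- The matrix elements of a Gaussian state decay geometrically. -/
theorem exists_norm_gaussianMatrix_le {N : ℝ} (hN : 0 < N) (θ : ℂ) :
    ∃ C v : ℝ, 0 ≤ C ∧ 0 < v ∧ v < 1 ∧ ∀ a l, ‖gaussianMatrix θ N a l‖ ≤ C * (v ^ a * v ^ l) := by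
  -- The excess `u² - 1 = 1/(2N)` is positive, which gives decay, and stays below `1/N`, which keeps
  -- the Gaussian integrable.
  set u : ℝ := √(1 + N⁻¹ / 2) with hu
  have hNi : 0 < N⁻¹ := inv_pos.2 hN
  have hu2 : u ^ 2 = 1 + N⁻¹ / 2 := Real.sq_sqrt (by positivity)
  have hu1 : 1 < u := by
    rw [hu, Real.lt_sqrt zero_le_one]
    linarith
  have hu0 : 0 < u := by linarith
  have hint := integrable_gaussian_mul_exp (N := N) (δ := u ^ 2 - 1) (by rw [hu2]; linarith) θ
  refine ⟨‖1 / (Real.pi * N)‖ *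
    ∫ ξ : ℂ, Real.exp (-‖θ - ξ‖ ^ 2 / N) * Real.exp ((u ^ 2 - 1) * ‖ξ‖ ^ 2), u⁻¹,
    mul_nonneg (norm_nonneg _) (integral_nonneg fun ξ => by positivity), inv_pos.2 hu0,
    inv_lt_one_of_one_lt₀ hu1, fun a l => ?_⟩
  rw [gaussianMatrix, norm_smul, mul_assoc]
  refine mul_le_mul_of_nonneg_left ?_ (norm_nonneg _)
  rw [← integral_mul_const]
  refine norm_integral_le_of_norm_le (hint.mul_const _) (Eventually.of_forall fun ξ => ?_)
  rw [norm_gaussianMatrix_integrand, mul_assoc]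
  refine mul_le_mul_of_nonneg_left ?_ (Real.exp_pos _).le
  calc _ ≤ (u⁻¹ ^ a * Real.exp ((u ^ 2 - 1) * ‖ξ‖ ^ 2 / 2)) *
        (u⁻¹ ^ l * Real.exp ((u ^ 2 - 1) * ‖ξ‖ ^ 2 / 2)) :=
        mul_le_mul (norm_coherent_apply_le hu0 ξ a) (norm_coherent_apply_le hu0 ξ l)
          (norm_nonneg _) (by positivity)
    _ = Real.exp ((u ^ 2 - 1) * ‖ξ‖ ^ 2 / 2 + (u ^ 2 - 1) * ‖ξ‖ ^ 2 / 2) * (u⁻¹ ^ a * u⁻¹ ^ l) := by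
        rw [Real.exp_add]
        ring
    _ = _ := by rw [add_halves]

theorem integral_circle_mul (w : Circle) {E : Type*} [NormedAddCommGroup E] [NormedSpace ℝ E]
    (f : ℂ → E) : ∫ ξ : ℂ, f ((w : ℂ) * ξ) = ∫ ξ : ℂ, f ξ :=
  (rotation w).measurePreserving.integral_comp (rotation w).toHomeomorph.measurableEmbedding f

/-- Substitute `ξ ↦ wξ`: rotating the displacement conjugates the state by `w` to the power of the
number operator. Diagonal entries are unaffected. -/
theorem gaussianMatrix_circle_mul (w : Circle) (θ : ℂ) (N : ℝ) (a l : ℕ) :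
    gaussianMatrix ((w : ℂ) * θ) N a l =
      (w : ℂ) ^ a * conj (w : ℂ) ^ l * gaussianMatrix θ N a l := by
  rw [gaussianMatrix, gaussianMatrix, ← integral_circle_mul w, mul_smul_comm]
  rw [← integral_const_mul]
  congr 2
  funext ξ
  rw [← mul_sub, norm_mul, Circle.norm_coe, one_mul, coherent_mul, coherent_mul, map_mul, map_pow,
    mul_smul_comm]
  congr 1
  ring

/-! ### Complex Gaussian moments -/

theorem circle_exp_pow_mul_conj_pow (i j : ℕ) (x : ℝ) :
    (Circle.exp x : ℂ) ^ i * conj (Circle.exp x : ℂ) ^ j =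
      Complex.exp (((i : ℂ) - j) * x * Complex.I) := by
  rw [Circle.coe_exp, ← Complex.exp_conj, ← Complex.exp_nat_mul, ← Complex.exp_nat_mul,
    ← Complex.exp_add]
  congr 1
  simp
  ring

theorem integral_moment_of_ne {i j : ℕ} (hij : i ≠ j) (c : ℝ) :
    ∫ ξ : ℂ, (Real.exp (-c * ‖ξ‖ ^ 2) : ℂ) * (ξ ^ i * conj ξ ^ j) = 0 := by
  have hne : (i : ℂ) - j ≠ 0 := sub_ne_zero.2 (by exact_mod_cast hij)
  -- Rotation by this angle changes the sign of the integrand, so the integral equals its own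
  -- negative.
  set w : Circle := Circle.exp (Real.pi / ((i : ℝ) - j)) with hw
  have hw1 : (w : ℂ) ^ i * conj (w : ℂ) ^ j = -1 := by
    rw [hw, circle_exp_pow_mul_conj_pow, ← Complex.exp_pi_mul_I]
    congr 1
    push_cast
    field_simp
  have h : ∫ ξ : ℂ, (Real.exp (-c * ‖ξ‖ ^ 2) : ℂ) * (ξ ^ i * conj ξ ^ j) =
      -∫ ξ : ℂ, (Real.exp (-c * ‖ξ‖ ^ 2) : ℂ) * (ξ ^ i * conj ξ ^ j) := by
    conv_lhs => rw [← integral_circle_mul w]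
    rw [← integral_neg]
    congr 1
    funext ξ
    rw [norm_mul, Circle.norm_coe, one_mul, map_mul, mul_pow, mul_pow]
    linear_combination (Real.exp (-c * ‖ξ‖ ^ 2) : ℂ) * (ξ ^ i * conj ξ ^ j) * hw1
  exact self_eq_neg.1 h

theorem integral_moment_self (i : ℕ) {c : ℝ} (hc : 0 < c) :
    ∫ ξ : ℂ, (Real.exp (-c * ‖ξ‖ ^ 2) : ℂ) * (ξ ^ i * conj ξ ^ i) =
      ((Real.pi * i.factorial / c ^ (i + 1) : ℝ) : ℂ) := by
  have h := Complex.integral_rpow_mul_exp_neg_mul_rpow (p := 2) (q := ((2 * i : ℕ) : ℝ))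
    one_le_two (lt_of_lt_of_le (by norm_num) (Nat.cast_nonneg _)) hc
  have h1 : (((2 * i : ℕ) : ℝ) + 2) / 2 = (i : ℝ) + 1 := by
    push_cast
    ring
  have h2 : -(((2 * i : ℕ) : ℝ) + 2) / 2 = -((i + 1 : ℕ) : ℝ) := by
    push_cast
    ring
  rw [h1, h2, Real.Gamma_nat_eq_factorial, Real.rpow_neg hc.le, Real.rpow_natCast] at h
  rw [show Real.pi * i.factorial / c ^ (i + 1) =
    2 * Real.pi / 2 * (c ^ (i + 1))⁻¹ * i.factorial by ring, ← h, ← integral_complex_ofReal]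
  congr 1
  funext ξ
  rw [← mul_pow, Complex.mul_conj, Complex.normSq_eq_norm_sq, Real.rpow_natCast,
    Real.rpow_two, pow_mul]
  push_cast
  ring

theorem coherent_mul_conj_coherent (ξ : ℂ) (a l : ℕ) : coherent ξ a * conj (coherent ξ l) =
    (Real.exp (-‖ξ‖ ^ 2) : ℂ) * (ξ ^ a * conj ξ ^ l) /
      ((Real.sqrt a.factorial : ℝ) * (Real.sqrt l.factorial : ℝ) : ℂ) := by
  have h : (Real.exp (-‖ξ‖ ^ 2) : ℂ) =
      (Real.exp (-‖ξ‖ ^ 2 / 2) : ℂ) * (Real.exp (-‖ξ‖ ^ 2 / 2) : ℂ) := by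
    rw [← Complex.ofReal_mul, ← Real.exp_add, add_halves]
  rw [coherent_apply, coherent_apply, h]
  simp only [map_mul, map_div₀, map_pow, Complex.conj_ofReal]
  ring

theorem gaussian_zero_smul_coherent (ξ : ℂ) (N : ℝ) (a l : ℕ) :
    Real.exp (-‖ξ‖ ^ 2 / N) • (coherent ξ a * conj (coherent ξ l)) =
      ((Real.sqrt a.factorial : ℝ) * (Real.sqrt l.factorial : ℝ) : ℂ)⁻¹ *
        ((Real.exp (-(1 + N⁻¹) * ‖ξ‖ ^ 2) : ℂ) * (ξ ^ a * conj ξ ^ l)) := by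
  rw [show -(1 + N⁻¹) * ‖ξ‖ ^ 2 = -‖ξ‖ ^ 2 / N + -‖ξ‖ ^ 2 by ring, Real.exp_add,
    coherent_mul_conj_coherent, Complex.real_smul]
  push_cast
  ring

/-- The ratio `N / (N + 1)` of the geometric photon distribution of the thermal state. -/
def thermalRatio (N : ℝ) : ℝ := N / (N + 1)

theorem thermalRatio_pos {N : ℝ} (hN : 0 < N) : 0 < thermalRatio N := by
  unfold thermalRatio
  positivity

theorem thermalRatio_lt_one {N : ℝ} (hN : 0 < N) : thermalRatio N < 1 := by
  unfold thermalRatio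
  rw [div_lt_one (by positivity)]
  linarith

theorem one_sub_thermalRatio {N : ℝ} (hN : 0 < N) : 1 - thermalRatio N = 1 / (N + 1) := by
  rw [thermalRatio, eq_div_iff (by positivity), sub_mul, div_mul_cancel₀ _ (by positivity)]
  ring

theorem thermalRatio_eq_inv {N : ℝ} (hN : 0 < N) : thermalRatio N = (1 + N⁻¹)⁻¹ := by
  unfold thermalRatio
  field_simp

/-- The thermal state is diagonal in the number basis, with the geometric distribution. -/
theorem gaussianMatrix_zero {N : ℝ} (hN : 0 < N) (a l : ℕ) : gaussianMatrix 0 N a l =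
    if a = l then (((1 - thermalRatio N) * thermalRatio N ^ a : ℝ) : ℂ) else 0 := by
  have h0 : gaussianMatrix 0 N a l = (1 / (Real.pi * N)) •
      (((Real.sqrt a.factorial : ℝ) * (Real.sqrt l.factorial : ℝ) : ℂ)⁻¹ *
        ∫ ξ : ℂ, (Real.exp (-(1 + N⁻¹) * ‖ξ‖ ^ 2) : ℂ) * (ξ ^ a * conj ξ ^ l)) := by
    rw [gaussianMatrix, ← integral_const_mul]
    simp only [zero_sub, norm_neg, gaussian_zero_smul_coherent]
  rw [h0]
  split_ifs with h
  · subst h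
    rw [integral_moment_self a (c := 1 + N⁻¹) (by positivity), ofReal_sqrt_factorial_mul_self,
      Complex.real_smul, one_sub_thermalRatio hN, thermalRatio_eq_inv hN]
    have ha : (a.factorial : ℂ) ≠ 0 := by exact_mod_cast a.factorial_ne_zero
    have hc : (1 + (N : ℂ)⁻¹) ≠ 0 := by
      have : (1 + N⁻¹) ≠ 0 := by positivity
      exact_mod_cast this
    have hN0 : (N : ℂ) ≠ 0 := by exact_mod_cast hN.ne'
    have hN1 : (N : ℂ) + 1 ≠ 0 := by
      have : N + 1 ≠ 0 := by positivity
      exact_mod_cast this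
    have hpi : (Real.pi : ℂ) ≠ 0 := by exact_mod_cast Real.pi_ne_zero
    have h2 : (N : ℂ) + 1 = N * (1 + (N : ℂ)⁻¹) := by field_simp
    push_cast
    rw [h2, pow_succ, inv_pow]
    field_simp
  · rw [integral_moment_of_ne h, mul_zero, smul_zero]

/-! ### The photon number distribution of a displaced thermal state -/

/-- The `j`-th term of the series for the likelihood ratio of the photon number distributions of
`ρ_{r,N}` and `ρ_{0,N}` at `a`. -/
def likelihoodTerm (r N : ℝ) (a j : ℕ) : ℝ :=
  Real.exp (-r ^ 2 / N) *
    (((a + j).choose a : ℝ) / j.factorial * ((r / N) ^ 2 * thermalRatio N) ^ j)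

theorem norm_coherent_apply_le_one (ξ : ℂ) (a : ℕ) : ‖coherent ξ a‖ ≤ 1 := by
  simpa using norm_coherent_apply_le one_pos ξ a

/-- The cross term `2r Re ξ / N` splits as `tξ + t conj ξ` with `t = r/N`. Expanding both
exponentials leaves only monomials in `ξ` and `conj ξ` against a centred Gaussian. -/
theorem gaussian_eq_mul_exp_mul_exp (r N : ℝ) (ξ : ℂ) :
    (Real.exp (-‖(r : ℂ) - ξ‖ ^ 2 / N) : ℂ) = (Real.exp (-r ^ 2 / N) : ℂ) *
      ((Real.exp (-‖ξ‖ ^ 2 / N) : ℂ) *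
        (Complex.exp ((r / N : ℝ) * ξ) * Complex.exp ((r / N : ℝ) * conj ξ))) := by
  rw [norm_sub_sq_div, ← Complex.exp_add, ← mul_add, Complex.add_conj, Complex.inner,
    Complex.norm_real, Real.norm_eq_abs, sq_abs]
  push_cast
  rw [← Complex.exp_add, ← Complex.exp_add]
  congr 1
  simp
  ring

theorem integrable_gaussian_mul_exp_mul_norm {N : ℝ} (hN : 0 < N) (t : ℝ) :
    Integrable fun ξ : ℂ => Real.exp (-‖ξ‖ ^ 2 / N) * Real.exp (t * ‖ξ‖) := by
  have h := integrable_gaussian_mul_exp (N := N) (δ := N⁻¹ / 2) (half_lt_self (inv_pos.2 hN)) 0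
  simp only [zero_sub, norm_neg] at h
  refine (h.mul_const (Real.exp (t ^ 2 * N / 2))).mono
    (Continuous.aestronglyMeasurable (by fun_prop)) (Eventually.of_forall fun ξ => ?_)
  rw [Real.norm_of_nonneg (by positivity), Real.norm_of_nonneg (by positivity), mul_assoc,
    ← Real.exp_add (N⁻¹ / 2 * ‖ξ‖ ^ 2)]
  refine mul_le_mul_of_nonneg_left (Real.exp_le_exp.2 ?_) (Real.exp_pos _).le
  -- Completing the square: the linear exponent is at most half of the available quadratic one plus
  -- a constant.
  have h2 : 0 ≤ N⁻¹ / 2 * (‖ξ‖ - t * N) ^ 2 := by positivity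
  have h3 : N⁻¹ / 2 * (‖ξ‖ - t * N) ^ 2 =
      N⁻¹ / 2 * ‖ξ‖ ^ 2 + t ^ 2 * N / 2 - t * ‖ξ‖ := by
    field_simp
    ring
  linarith

theorem hasSum_exp_mul_exp (x y : ℂ) : HasSum (fun p : ℕ × ℕ =>
    x ^ p.1 / p.1.factorial * (y ^ p.2 / p.2.factorial)) (Complex.exp x * Complex.exp y) := by
  have hx := NormedSpace.norm_expSeries_div_summable x
  have hy := NormedSpace.norm_expSeries_div_summable y
  rw [Complex.exp_eq_exp_ℂ, ← (NormedSpace.expSeries_div_hasSum_exp x).tsum_eq,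
    ← (NormedSpace.expSeries_div_hasSum_exp y).tsum_eq, tsum_mul_tsum_of_summable_norm hx hy]
  exact (summable_mul_of_summable_norm hx hy).hasSum

theorem hasSum_real_exp_mul_exp (x y : ℝ) : HasSum (fun p : ℕ × ℕ =>
    x ^ p.1 / p.1.factorial * (y ^ p.2 / p.2.factorial)) (Real.exp x * Real.exp y) := by
  have h := hasSum_exp_mul_exp x y
  norm_cast at h

/-- Termwise integration by dominated convergence: coherent coefficients are at most `1`, and the
absolute series sums to `e^{2|t||ξ|}`, which is integrable against the Gaussian. -/
theorem hasSum_integral_gaussian_exp {N : ℝ} (hN : 0 < N) (t : ℝ) (a : ℕ) :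
    HasSum (fun p : ℕ × ℕ => ∫ ξ : ℂ, (Real.exp (-‖ξ‖ ^ 2 / N) •
        (coherent ξ a * conj (coherent ξ a))) *
        ((t * ξ) ^ p.1 / p.1.factorial * ((t * conj ξ) ^ p.2 / p.2.factorial)))
      (∫ ξ : ℂ, (Real.exp (-‖ξ‖ ^ 2 / N) • (coherent ξ a * conj (coherent ξ a))) *
        (Complex.exp (t * ξ) * Complex.exp (t * conj ξ))) := by
  have hA : Continuous fun ξ : ℂ =>
      Real.exp (-‖ξ‖ ^ 2 / N) • (coherent ξ a * conj (coherent ξ a)) := by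
    have h1 : Continuous fun ξ : ℂ => Real.exp (-‖ξ‖ ^ 2 / N) := by fun_prop
    exact h1.smul ((continuous_coherent_apply a).mul
      (Complex.continuous_conj.comp (continuous_coherent_apply a)))
  have hbs : ∀ ξ : ℂ, HasSum (fun p : ℕ × ℕ => Real.exp (-‖ξ‖ ^ 2 / N) *
      ((|t| * ‖ξ‖) ^ p.1 / p.1.factorial * ((|t| * ‖ξ‖) ^ p.2 / p.2.factorial)))
      (Real.exp (-‖ξ‖ ^ 2 / N) * Real.exp ((2 * |t|) * ‖ξ‖)) := by
    intro ξ
    have h := (hasSum_real_exp_mul_exp (|t| * ‖ξ‖) (|t| * ‖ξ‖)).mul_left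
      (Real.exp (-‖ξ‖ ^ 2 / N))
    rwa [← Real.exp_add (|t| * ‖ξ‖), ← two_mul, ← mul_assoc 2] at h
  refine hasSum_integral_of_dominated_convergence (fun (p : ℕ × ℕ) ξ => Real.exp (-‖ξ‖ ^ 2 / N) *
    ((|t| * ‖ξ‖) ^ p.1 / p.1.factorial * ((|t| * ‖ξ‖) ^ p.2 / p.2.factorial)))
    (fun p => (hA.mul (by fun_prop)).aestronglyMeasurable)
    (fun p => Eventually.of_forall fun ξ => ?_)
    (Eventually.of_forall fun ξ => (hbs ξ).summable) ?_
    (Eventually.of_forall fun ξ => (hasSum_exp_mul_exp _ _).mul_left _)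
  · rw [norm_mul, norm_smul, norm_mul, RCLike.norm_conj, Real.norm_of_nonneg (Real.exp_pos _).le]
    refine mul_le_mul ?_ (le_of_eq ?_) (norm_nonneg _) (Real.exp_pos _).le
    · refine mul_le_of_le_one_right (Real.exp_pos _).le ?_
      exact mul_le_one₀ (norm_coherent_apply_le_one ξ a) (norm_nonneg _)
        (norm_coherent_apply_le_one ξ a)
    · simp
  · simp only [(hbs _).tsum_eq]
    exact integrable_gaussian_mul_exp_mul_norm hN _

theorem integral_gaussian_moment (N t : ℝ) (a i j : ℕ) :
    ∫ ξ : ℂ, (Real.exp (-‖ξ‖ ^ 2 / N) • (coherent ξ a * conj (coherent ξ a))) *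
        ((t * ξ) ^ i / i.factorial * ((t * conj ξ) ^ j / j.factorial)) =
      (t : ℂ) ^ (i + j) / (a.factorial * i.factorial * j.factorial) *
        ∫ ξ : ℂ, (Real.exp (-(1 + N⁻¹) * ‖ξ‖ ^ 2) : ℂ) * (ξ ^ (a + i) * conj ξ ^ (a + j)) := by
  rw [← integral_const_mul]
  congr 1
  funext ξ
  rw [gaussian_zero_smul_coherent, ofReal_sqrt_factorial_mul_self]
  ring

theorem hasSum_gaussianMatrix_self {N : ℝ} (hN : 0 < N) (r : ℝ) (a : ℕ) :
    HasSum (fun j => (((1 - thermalRatio N) * thermalRatio N ^ a * likelihoodTerm r N a j : ℝ) : ℂ))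
      (gaussianMatrix r N a a) := by
  have hM : gaussianMatrix r N a a = ((1 / (Real.pi * N) * Real.exp (-r ^ 2 / N) : ℝ) : ℂ) *
      ∫ ξ : ℂ, (Real.exp (-‖ξ‖ ^ 2 / N) • (coherent ξ a * conj (coherent ξ a))) *
        (Complex.exp ((r / N : ℝ) * ξ) * Complex.exp ((r / N : ℝ) * conj ξ)) := by
    rw [gaussianMatrix, Complex.real_smul, Complex.ofReal_mul, mul_assoc]
    congr 1
    rw [← integral_const_mul]
    congr 1
    funext ξ
    rw [Complex.real_smul, Complex.real_smul, gaussian_eq_mul_exp_mul_exp]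
    ring
  have h := (hasSum_integral_gaussian_exp hN (r / N) a).mul_left
    ((1 / (Real.pi * N) * Real.exp (-r ^ 2 / N) : ℝ) : ℂ)
  rw [← hM] at h
  -- Moments with unequal exponents vanish, so the double series collapses to its diagonal.
  have hinj : Function.Injective fun j : ℕ => (j, j) := fun i j hij => congrArg Prod.fst hij
  rw [← hinj.hasSum_iff] at h
  · refine h.congr_fun fun j => ?_
    simp only [Function.comp]
    rw [integral_gaussian_moment, integral_moment_self (a + j) (c := 1 + N⁻¹) (by positivity)]
    have hc : (a + j).choose a * (a.factorial * j.factorial) = (a + j).factorial := by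
      have h' := Nat.choose_mul_factorial_mul_factorial (Nat.le_add_right a j)
      rwa [Nat.add_sub_cancel_left, mul_assoc] at h'
    have hc' : ((a + j).factorial : ℝ) = (a + j).choose a * (a.factorial * j.factorial) := by
      exact_mod_cast hc.symm
    have hn : N + 1 = N * (1 + N⁻¹) := by field_simp
    have hq : 0 < 1 + N⁻¹ := by positivity
    have key : (1 - thermalRatio N) * thermalRatio N ^ a * likelihoodTerm r N a j =
        1 / (Real.pi * N) * Real.exp (-r ^ 2 / N) *
          ((r / N) ^ (j + j) / (a.factorial * j.factorial * j.factorial) *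
            (Real.pi * (a + j).factorial / (1 + N⁻¹) ^ (a + j + 1))) := by
      rw [likelihoodTerm, one_sub_thermalRatio hN, thermalRatio_eq_inv hN, hn, hc']
      have ha : (a.factorial : ℝ) ≠ 0 := by exact_mod_cast a.factorial_ne_zero
      have hj : (j.factorial : ℝ) ≠ 0 := by exact_mod_cast j.factorial_ne_zero
      have hpi := Real.pi_pos
      generalize 1 + N⁻¹ = c at hq
      generalize r / N = t
      generalize Real.exp (-r ^ 2 / N) = e
      rw [← two_mul j, pow_mul t, mul_pow, inv_pow, inv_pow, pow_add, pow_add, pow_one]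
      field_simp
    rw [key]
    push_cast
    ring
  · rintro ⟨i, j⟩ hij
    have hne : a + i ≠ a + j := fun h' => hij ⟨i, by simp; omega⟩
    rw [integral_gaussian_moment, integral_moment_of_ne hne, mul_zero, mul_zero]

/-- The photon number distribution of `ρ_{r,N}`. -/
def photonProb (r N : ℝ) (a : ℕ) : ℝ := (gaussianMatrix r N a a).re

/-- The likelihood ratio of the photon number distributions of `ρ_{r,N}` and `ρ_{0,N}`. -/
def likelihoodRatio (r N : ℝ) (a : ℕ) : ℝ := ∑' j, likelihoodTerm r N a j

theorem summable_likelihoodTerm {N : ℝ} (hN : 0 < N) (r : ℝ) (a : ℕ) :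
    Summable (likelihoodTerm r N a) := by
  have h := (Complex.hasSum_re (hasSum_gaussianMatrix_self hN r a)).summable
  simp only [Complex.ofReal_re] at h
  refine (summable_mul_left_iff ?_).1 h
  have h1 := thermalRatio_pos hN
  have h2 := sub_pos.2 (thermalRatio_lt_one hN)
  positivity

theorem gaussianMatrix_self {N : ℝ} (hN : 0 < N) (r : ℝ) (a : ℕ) :
    gaussianMatrix r N a a = (photonProb r N a : ℂ) := by
  have h := hasSum_gaussianMatrix_self hN r a
  have h2 := Complex.hasSum_ofReal.2 (Complex.hasSum_re h)
  simp only [Complex.ofReal_re] at h2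
  exact h.unique h2

theorem photonProb_eq {N : ℝ} (hN : 0 < N) (r : ℝ) (a : ℕ) : photonProb r N a =
    (1 - thermalRatio N) * thermalRatio N ^ a * likelihoodRatio r N a := by
  have h := Complex.hasSum_re (hasSum_gaussianMatrix_self hN r a)
  simp only [Complex.ofReal_re] at h
  exact h.unique ((summable_likelihoodTerm hN r a).hasSum.mul_left _)

theorem likelihoodTerm_nonneg {N : ℝ} (hN : 0 < N) (r : ℝ) (a j : ℕ) :
    0 ≤ likelihoodTerm r N a j := by
  have h1 := thermalRatio_pos hN
  unfold likelihoodTerm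
  positivity

/-- In each term only the binomial coefficient depends on `a`, and it grows by Pascal's rule. -/
theorem likelihoodRatio_monotone {N : ℝ} (hN : 0 < N) (r : ℝ) :
    Monotone (likelihoodRatio r N) := by
  refine monotone_nat_of_le_succ fun a => ?_
  refine (summable_likelihoodTerm hN r a).tsum_le_tsum (fun j => ?_)
    (summable_likelihoodTerm hN r (a + 1))
  have h1 := thermalRatio_pos hN
  unfold likelihoodTerm
  have h2 : (a + j).choose a ≤ (a + 1 + j).choose (a + 1) := by
    rw [show a + 1 + j = (a + j) + 1 by ring, Nat.choose_succ_succ]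
    omega
  have h3 : ((a + j).choose a : ℝ) ≤ ((a + 1 + j).choose (a + 1) : ℕ) := by exact_mod_cast h2
  gcongr

/-- The bound is the term `j = 0`. It is uniform in `a` and tends to `1` as `r → 0`, which is how
unbiasedness is carried to the boundary. -/
theorem exp_le_likelihoodRatio {N : ℝ} (hN : 0 < N) (r : ℝ) (a : ℕ) :
    Real.exp (-r ^ 2 / N) ≤ likelihoodRatio r N a := by
  have h := (summable_likelihoodTerm hN r a).le_tsum 0
    (fun j _ => likelihoodTerm_nonneg hN r a j)
  refine le_trans (le_of_eq ?_) h
  simp [likelihoodTerm]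

theorem photonProb_nonneg {N : ℝ} (hN : 0 < N) (r : ℝ) (a : ℕ) : 0 ≤ photonProb r N a := by
  rw [photonProb_eq hN]
  have h1 := thermalRatio_pos hN
  have h2 := sub_pos.2 (thermalRatio_lt_one hN)
  have h3 := (Real.exp_pos _).trans_le (exp_le_likelihoodRatio hN r a)
  positivity

/-- Parseval for the unit vector `|ξ)`, integrated against the normalised Gaussian. -/
theorem hasSum_photonProb {N : ℝ} (hN : 0 < N) (r : ℝ) : HasSum (photonProb r N) 1 := by
  have hsum : ∀ ξ : ℂ, HasSum (fun a => ‖coherent ξ a‖ ^ 2) 1 := fun ξ => by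
    have h := (coherent ξ).summable.hasSum
    rwa [← Fock.norm_sq, norm_coherent, one_pow] at h
  have hg := integrable_gaussian hN r
  have hc : ∀ a, Continuous fun ξ : ℂ =>
      Real.exp (-‖(r : ℂ) - ξ‖ ^ 2 / N) * ‖coherent ξ a‖ ^ 2 := fun a => by
    have := continuous_coherent_apply a
    fun_prop
  have h := hasSum_integral_of_dominated_convergence (μ := (volume : Measure ℂ))
    (F := fun a ξ => Real.exp (-‖(r : ℂ) - ξ‖ ^ 2 / N) * ‖coherent ξ a‖ ^ 2)
    (f := fun ξ => Real.exp (-‖(r : ℂ) - ξ‖ ^ 2 / N) * 1)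
    (fun a ξ => Real.exp (-‖(r : ℂ) - ξ‖ ^ 2 / N) * ‖coherent ξ a‖ ^ 2)
    (fun a => (hc a).aestronglyMeasurable)
    (fun a => Eventually.of_forall fun ξ => (Real.norm_of_nonneg (by positivity)).le)
    (Eventually.of_forall fun ξ => ((hsum ξ).mul_left _).summable)
    (by simpa only [((hsum _).mul_left _).tsum_eq, mul_one] using hg)
    (Eventually.of_forall fun ξ => (hsum ξ).mul_left _)
  simp only [mul_one] at h
  have h2 := h.mul_left (1 / (Real.pi * N))
  rw [integral_gaussian_complex hN, one_div_mul_cancel (by positivity)] at h2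
  refine h2.congr_fun fun a => ?_
  have h3 : gaussianMatrix r N a a = ((1 / (Real.pi * N) *
      ∫ ξ : ℂ, Real.exp (-‖(r : ℂ) - ξ‖ ^ 2 / N) * ‖coherent ξ a‖ ^ 2 : ℝ) : ℂ) := by
    rw [gaussianMatrix, Complex.ofReal_mul, Complex.real_smul, ← integral_complex_ofReal]
    congr 2
    funext ξ
    rw [Complex.mul_conj, Complex.normSq_eq_norm_sq, Complex.real_smul]
    push_cast
    rfl
  rw [photonProb, h3, Complex.ofReal_re]

/-! ### Counting modes with a given total count -/

/-- The multi-indices with total `s`. -/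
def countFiber (d s : ℕ) : Finset (Fin d → ℕ) := Finset.piAntidiag Finset.univ s

theorem mem_countFiber {d s : ℕ} {k : Fin d → ℕ} : k ∈ countFiber d s ↔ ∑ j, k j = s := by
  simp [countFiber]

/-- Stars and bars: the fiber is in bijection with multisets of size `s` on `d` symbols. -/
theorem card_countFiber {d : ℕ} (hd : 1 ≤ d) (s : ℕ) :
    (countFiber d s).card = (s + d - 1).choose (d - 1) := by
  have e : countFiber d s ≃ Sym (Fin d) s :=
    (Equiv.subtypeEquivRight fun k => mem_countFiber).trans
      (Sym.equivNatSumOfFintype (Fin d) s).symm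
  have h := Fintype.card_congr e
  rw [Fintype.card_coe, Sym.card_sym_eq_choose, Fintype.card_fin] at h
  rw [h, add_comm d s, ← Nat.choose_symm (by omega)]
  congr 1
  omega

theorem hasSum_countFiber {d : ℕ} {f : (Fin d → ℕ) → ℝ} {a : ℝ} (h : HasSum f a) :
    HasSum (fun s => ∑ k ∈ countFiber d s, f k) a := by
  have h2 := h.tsum_fiberwise fun k => ∑ j, k j
  refine h2.congr_fun fun s => ?_
  have hs : (fun k : Fin d → ℕ => ∑ j, k j) ⁻¹' {s} = ↑(countFiber d s) := by
    ext k
    simp [mem_countFiber]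
  rw [hs, Finset.tsum_subtype']

theorem card_countFiber_filter (d s l : ℕ) (hl : l ≤ s) :
    ((countFiber (d + 1) s).filter fun k => k 0 = l).card = (countFiber d (s - l)).card := by
  refine Finset.card_bij' (fun k _ => Fin.tail k) (fun m _ => Fin.cons l m) ?_ ?_ ?_ ?_
  · intro k hk
    rw [Finset.mem_filter, mem_countFiber, Fin.sum_univ_succ] at hk
    rw [mem_countFiber]
    simp only [Fin.tail]
    omega
  · intro m hm
    rw [mem_countFiber] at hm
    rw [Finset.mem_filter, mem_countFiber, Fin.sum_univ_succ]
    simp only [Fin.cons_zero, Fin.cons_succ, and_true]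
    omega
  · intro k hk
    rw [Finset.mem_filter] at hk
    rw [← hk.2]
    exact Fin.cons_self_tail k
  · intro m _
    exact Fin.tail_cons _ _

theorem apply_zero_le_of_mem_countFiber {d s : ℕ} {k : Fin (d + 1) → ℕ}
    (hk : k ∈ countFiber (d + 1) s) : k 0 ≤ s := by
  rw [mem_countFiber] at hk
  rw [← hk]
  exact Finset.single_le_sum (f := k) (fun _ _ => Nat.zero_le _) (Finset.mem_univ 0)

theorem sum_countFiber {n : ℕ} (hn : 1 ≤ n) (s : ℕ) (g : ℕ → ℝ) :
    ∑ k ∈ countFiber (n + 1) s, g (k 0) =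
      ∑ l ∈ Finset.Icc 0 s, ((s - l + n - 1).choose (n - 1) : ℝ) * g l := by
  rw [← Finset.sum_fiberwise_of_maps_to (g := fun k : Fin (n + 1) → ℕ => k 0)
    (t := Finset.Icc 0 s)
    (fun k hk => Finset.mem_Icc.2 ⟨Nat.zero_le _, apply_zero_le_of_mem_countFiber hk⟩)]
  refine Finset.sum_congr rfl fun l hl => ?_
  rw [Finset.sum_congr rfl (g := fun _ => g l) fun k hk => by rw [(Finset.mem_filter.1 hk).2],
    Finset.sum_const, card_countFiber_filter n s l (Finset.mem_Icc.1 hl).2, card_countFiber hn,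
    nsmul_eq_mul]

/-! ### The threshold -/

/-- The number of multi-indices with total `s` and first entry at least `j`. -/
def upperCount (n s j : ℕ) : ℝ := ∑ l ∈ Finset.Icc j s, ((s - l + n - 1).choose (n - 1) : ℝ)

theorem upperCount_zero {n : ℕ} (hn : 1 ≤ n) (s : ℕ) :
    upperCount n s 0 = ((s + n).choose n : ℝ) := by
  have h := sum_countFiber hn s fun _ => 1
  simp only [mul_one, Finset.sum_const, nsmul_eq_mul] at h
  rw [upperCount, ← h, card_countFiber (by omega)]
  simp

theorem upperCount_antitone (n s : ℕ) : Antitone (upperCount n s) := fun _ _ hij =>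
  Finset.sum_le_sum_of_subset_of_nonneg (Finset.Icc_subset_Icc_left hij)
    fun _ _ _ => Nat.cast_nonneg _

theorem upperCount_of_lt {n s j : ℕ} (h : s < j) : upperCount n s j = 0 := by
  rw [upperCount, Finset.Icc_eq_empty (by omega), Finset.sum_empty]

theorem upperCount_succ (n : ℕ) {s j : ℕ} (h : j ≤ s) :
    upperCount n s j = ((s - j + n - 1).choose (n - 1) : ℝ) + upperCount n s (j + 1) := by
  have hs : Finset.Icc (j + 1) s = Finset.Ioc j s := by
    ext l
    simp
  rw [upperCount, upperCount, hs]
  exact (Finset.add_sum_Ioc_eq_sum_Icc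
    (f := fun l => ((s - l + n - 1).choose (n - 1) : ℝ)) h).symm

theorem choose_cast_pos {a b : ℕ} (h : b ≤ a) : 0 < (a.choose b : ℝ) := by
  exact_mod_cast Nat.choose_pos h

theorem exists_threshold {n : ℕ} (hn : 1 ≤ n) {α : ℝ} (hα : α ∈ Set.Ioo (0 : ℝ) 1) (s : ℕ) :
    ∃ c, upperCount n s (c + 1) < α * ((s + n).choose n : ℝ) ∧
      α * ((s + n).choose n : ℝ) ≤ upperCount n s c := by
  have hpos : 0 < ((s + n).choose n : ℝ) := choose_cast_pos (by omega)
  have hex : ∃ c, upperCount n s (c + 1) < α * ((s + n).choose n : ℝ) :=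
    ⟨s, by rw [upperCount_of_lt (by omega)]; exact mul_pos hα.1 hpos⟩
  classical
  -- The least `c` is taken. Minimality gives the second inequality, except at `c = 0`, where the
  -- tail is the whole fiber and `α < 1` suffices.
  refine ⟨Nat.find hex, Nat.find_spec hex, ?_⟩
  rcases Nat.eq_zero_or_eq_succ_pred (Nat.find hex) with h | h
  · rw [h, upperCount_zero hn]
    exact mul_le_of_le_one_left hpos.le hα.2.le
  · rw [h]
    exact not_lt.1 (Nat.find_min hex (Nat.pred_lt (by rw [h]; exact Nat.succ_ne_zero _)))

theorem threshold_unique {n s : ℕ} {x : ℝ} {c c' : ℕ}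
    (h1 : upperCount n s (c + 1) < x) (h2 : x ≤ upperCount n s c)
    (h1' : upperCount n s (c' + 1) < x) (h2' : x ≤ upperCount n s c') : c = c' := by
  have aux : ∀ {a b : ℕ}, upperCount n s (a + 1) < x → x ≤ upperCount n s b → b ≤ a := by
    intro a b ha hb
    by_contra hab
    exact absurd (hb.trans (upperCount_antitone n s (Nat.succ_le_of_lt (not_le.1 hab)))) ha.not_ge
  exact le_antisymm (aux h1' h2) (aux h1 h2')

theorem threshold_le {n s : ℕ} {x : ℝ} (hx : 0 < x) {c : ℕ} (h2 : x ≤ upperCount n s c) :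
    c ≤ s := by
  by_contra h
  rw [upperCount_of_lt (not_le.1 h)] at h2
  exact absurd h2 hx.not_ge

theorem existsUnique_isTThreshold {n : ℕ} (hn : 1 ≤ n) {α : ℝ} (hα : α ∈ Set.Ioo (0 : ℝ) 1) :
    ∃! p : (ℕ → ℕ) × (ℕ → Set.Ioc (0 : ℝ) 1), IsTThreshold n α p.1 p.2 := by
  choose c hc1 hc2 using exists_threshold hn hα
  have hx : ∀ s, 0 < α * ((s + n).choose n : ℝ) := fun s =>
    mul_pos hα.1 (choose_cast_pos (by omega))
  have hd : ∀ s, 0 < ((s - c s + n - 1).choose (n - 1) : ℝ) := fun s =>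
    choose_cast_pos (by omega)
  have hγ : ∀ s, (α * ((s + n).choose n : ℝ) - upperCount n s (c s + 1)) /
      ((s - c s + n - 1).choose (n - 1) : ℝ) ∈ Set.Ioc (0 : ℝ) 1 := fun s => by
    refine ⟨div_pos (sub_pos.2 (hc1 s)) (hd s), ?_⟩
    rw [div_le_one (hd s), sub_le_iff_le_add, ← upperCount_succ n (threshold_le (hx s) (hc2 s))]
    exact hc2 s
  refine ⟨(c, fun s => ⟨_, hγ s⟩), fun s => ⟨hc1 s, hc2 s, rfl⟩, ?_⟩
  rintro ⟨c', γ'⟩ h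
  have hcc : c' = c := funext fun s => threshold_unique (h s).1 (h s).2.1 (hc1 s) (hc2 s)
  subst hcc
  refine Prod.ext rfl (funext fun s => Subtype.ext ?_)
  exact (h s).2.2

theorem coe_tTestFun {n : ℕ} (c : ℕ → ℕ) (γ : ℕ → Set.Ioc (0 : ℝ) 1) (k : Fin (n + 1) → ℕ) :
    (tTestFun c γ k : ℝ) = (if c (totalCount k) + 1 ≤ k 0 then 1 else 0) +
      (if k 0 = c (totalCount k) then (γ (totalCount k) : ℝ) else 0) := by
  unfold tTestFun
  rcases lt_trichotomy (k 0) (c (totalCount k)) with h | h | h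
  · rw [if_pos h, if_neg (by omega), if_neg h.ne]
    simp
  · rw [if_neg (by omega), if_pos h, if_neg (by omega), if_pos h, zero_add]
  · rw [if_neg (by omega), if_neg h.ne', if_pos (by omega), if_neg h.ne']
    simp

/-- The `t` test has size exactly `α` on each fiber of the total count. -/
theorem sum_tTestFun {n : ℕ} (hn : 1 ≤ n) {α : ℝ} (hα : α ∈ Set.Ioo (0 : ℝ) 1) {c : ℕ → ℕ}
    {γ : ℕ → Set.Ioc (0 : ℝ) 1} (h : IsTThreshold n α c γ) (s : ℕ) :
    ∑ k ∈ countFiber (n + 1) s, (tTestFun c γ k : ℝ) = α * ((s + n).choose n : ℝ) := by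
  obtain ⟨h1, h2, h3⟩ := h s
  have hx : 0 < α * ((s + n).choose n : ℝ) := mul_pos hα.1 (choose_cast_pos (by omega))
  have hcs : c s ≤ s := threshold_le hx h2
  have hd : 0 < ((s - c s + n - 1).choose (n - 1) : ℝ) := choose_cast_pos (by omega)
  have e : ∑ k ∈ countFiber (n + 1) s, (tTestFun c γ k : ℝ) = ∑ k ∈ countFiber (n + 1) s,
      ((if c s + 1 ≤ k 0 then 1 else 0) + (if k 0 = c s then (γ s : ℝ) else 0)) := by
    refine Finset.sum_congr rfl fun k hk => ?_
    rw [coe_tTestFun, totalCount, mem_countFiber.1 hk]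
  rw [e, sum_countFiber hn s fun l =>
    (if c s + 1 ≤ l then 1 else 0) + (if l = c s then (γ s : ℝ) else 0)]
  simp only [mul_add, mul_ite, mul_one, mul_zero]
  rw [Finset.sum_add_distrib, Finset.sum_ite_eq' (Finset.Icc 0 s) (c s),
    if_pos (Finset.mem_Icc.2 ⟨Nat.zero_le _, hcs⟩), h3, ← Finset.sum_filter,
    mul_div_cancel₀ _ hd.ne']
  have hf : (Finset.Icc 0 s).filter (fun l => c s + 1 ≤ l) = Finset.Icc (c s + 1) s := by
    ext l
    simp only [Finset.mem_filter, Finset.mem_Icc]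
    omega
  rw [hf]
  ring

/-! ### Optimality on a fiber and completeness -/

/-- The Neyman–Pearson argument on a fiber of the total count. -/
theorem sum_mul_le_sum_mul_tTestFun {n : ℕ} {c : ℕ → ℕ} {γ : ℕ → Set.Ioc (0 : ℝ) 1} {L : ℕ → ℝ}
    (hL : Monotone L) {τ : (Fin (n + 1) → ℕ) → ℝ} (h0 : ∀ k, 0 ≤ τ k) (h1 : ∀ k, τ k ≤ 1) (s : ℕ)
    (hs : ∑ k ∈ countFiber (n + 1) s, τ k = ∑ k ∈ countFiber (n + 1) s, (tTestFun c γ k : ℝ)) :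
    ∑ k ∈ countFiber (n + 1) s, L (k 0) * τ k ≤
      ∑ k ∈ countFiber (n + 1) s, L (k 0) * (tTestFun c γ k : ℝ) := by
  -- Every summand is nonnegative: below the threshold the test is `0`, above it is `1`, and at the
  -- threshold the first factor vanishes, so the value of `γ` plays no role.
  have key : 0 ≤ ∑ k ∈ countFiber (n + 1) s,
      (L (k 0) - L (c s)) * ((tTestFun c γ k : ℝ) - τ k) := by
    refine Finset.sum_nonneg fun k hk => ?_
    have hk' : totalCount k = s := mem_countFiber.1 hk
    rw [coe_tTestFun, hk']
    rcases lt_trichotomy (k 0) (c s) with h | h | h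
    · rw [if_neg (by omega), if_neg h.ne, add_zero, zero_sub]
      exact mul_nonneg_of_nonpos_of_nonpos (sub_nonpos.2 (hL h.le)) (neg_nonpos.2 (h0 k))
    · rw [h, sub_self, zero_mul]
    · rw [if_pos (by omega), if_neg h.ne', add_zero]
      exact mul_nonneg (sub_nonneg.2 (hL h.le)) (sub_nonneg.2 (h1 k))
  have e : ∑ k ∈ countFiber (n + 1) s, (L (k 0) - L (c s)) * ((tTestFun c γ k : ℝ) - τ k) =
      ∑ k ∈ countFiber (n + 1) s, L (k 0) * (tTestFun c γ k : ℝ) -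
      ∑ k ∈ countFiber (n + 1) s, L (k 0) * τ k - L (c s) *
      (∑ k ∈ countFiber (n + 1) s, (tTestFun c γ k : ℝ) - ∑ k ∈ countFiber (n + 1) s, τ k) := by
    rw [mul_sub, Finset.mul_sum, Finset.mul_sum, ← Finset.sum_sub_distrib,
      ← Finset.sum_sub_distrib, ← Finset.sum_sub_distrib]
    exact Finset.sum_congr rfl fun k _ => by ring
  rw [e, hs, sub_self, mul_zero, sub_zero] at key
  exact sub_nonneg.1 key

/-- A power series which vanishes on `(0, 1)` has vanishing coefficients. -/
theorem eq_zero_of_hasSum_pow_mul {d : ℕ → ℝ}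
    (h : ∀ q ∈ Set.Ioo (0 : ℝ) 1, HasSum (fun s => q ^ s * d s) 0) (m : ℕ) : d m = 0 := by
  induction m using Nat.strong_induction_on with
  | _ m ih =>
    have hq : ∀ q ∈ Set.Ioo (0 : ℝ) 1, HasSum (fun s => q ^ s * d (s + m)) 0 := by
      intro q hq
      have h1 := (hasSum_nat_add_iff' m).2 (h q hq)
      rw [Finset.sum_eq_zero fun i hi => by rw [ih i (Finset.mem_range.1 hi), mul_zero],
        sub_zero] at h1
      have h2 := h1.mul_left (q ^ m)⁻¹
      rw [mul_zero] at h2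
      refine h2.congr_fun fun s => ?_
      have : q ^ m ≠ 0 := pow_ne_zero _ hq.1.ne'
      rw [pow_add]
      field_simp
    -- Absolute convergence at `q = 1/2` dominates all smaller `q`. The limit `q → 0+` can then be
    -- taken termwise, and `0 ^ 0 = 1` isolates `d m`.
    have hb : Summable fun s => (1 / 2 : ℝ) ^ s * |d (s + m)| := by
      have h2 := (hq (1 / 2) (by norm_num)).summable.abs
      refine h2.congr fun s => ?_
      rw [abs_mul, abs_of_nonneg (by positivity)]
    have hlim : Tendsto (fun q : ℝ => ∑' s, q ^ s * d (s + m)) (𝓝[>] 0)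
        (𝓝 (∑' s, (0 : ℝ) ^ s * d (s + m))) := by
      refine tendsto_tsum_of_dominated_convergence hb (fun s => ?_) ?_
      · have hc : Continuous fun q : ℝ => q ^ s * d (s + m) := by fun_prop
        exact (hc.tendsto 0).mono_left nhdsWithin_le_nhds
      · filter_upwards [Ioo_mem_nhdsGT (show (0 : ℝ) < 1 / 2 by norm_num)] with q hq s
        rw [norm_mul, Real.norm_eq_abs, Real.norm_eq_abs, abs_pow, abs_of_pos hq.1]
        gcongr
        exacts [hq.1.le, hq.2.le]
    have h0 : Tendsto (fun q : ℝ => ∑' s, q ^ s * d (s + m)) (𝓝[>] 0) (𝓝 0) := by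
      refine tendsto_const_nhds.congr' ?_
      filter_upwards [Ioo_mem_nhdsGT (show (0 : ℝ) < 1 by norm_num)] with q hq'
      exact (hq q hq').tsum_eq.symm
    have h3 := tendsto_nhds_unique hlim h0
    rw [tsum_eq_single 0 fun s hs => by rw [zero_pow hs, zero_mul]] at h3
    simpa using h3

theorem hasSum_prod_apply {f : ℕ → ℝ} (h0 : ∀ a, 0 ≤ f a) (h : HasSum f 1) (d : ℕ) :
    HasSum (fun k : Fin d → ℕ => ∏ j, f (k j)) 1 := by
  induction d with
  | zero =>
    simpa only [Finset.univ_eq_empty, Finset.prod_empty] using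
      hasSum_unique fun k : Fin 0 → ℕ => ∏ j, f (k j)
  | succ d ih =>
    have hs := h.summable.mul_of_nonneg ih.summable h0 fun k => Finset.prod_nonneg fun j _ => h0 _
    have h2 := h.mul ih hs
    rw [mul_one] at h2
    rw [← (Fin.consEquiv fun _ => ℕ).hasSum_iff]
    refine h2.congr_fun fun p => ?_
    simp [Fin.prod_univ_succ, Fin.consEquiv]

theorem hasSum_geometric_prob {q : ℝ} (hq : q ∈ Set.Ioo (0 : ℝ) 1) :
    HasSum (fun a => (1 - q) * q ^ a) 1 := by
  have h := (hasSum_geometric_of_lt_one hq.1.le hq.2).mul_left (1 - q)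
  rwa [mul_inv_cancel₀ (sub_pos.2 hq.2).ne'] at h

/-- Completeness of the total count for the thermal family. -/
theorem sum_countFiber_eq_of_tsum_eq {d : ℕ} {τ : (Fin d → ℕ) → ℝ} (h0 : ∀ k, 0 ≤ τ k)
    (h1 : ∀ k, τ k ≤ 1) {α : ℝ}
    (h : ∀ q ∈ Set.Ioo (0 : ℝ) 1, ∑' k, (∏ j, (1 - q) * q ^ k j) * τ k = α) (s : ℕ) :
    ∑ k ∈ countFiber d s, τ k = α * (countFiber d s).card := by
  -- Subtract `α` times the total mass `1`, group by the total and divide by `(1-q)^d`: what is left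
  -- is a power series in `q` vanishing on `(0, 1)`.
  refine sub_eq_zero.1 (eq_zero_of_hasSum_pow_mul (d := fun s =>
    ∑ k ∈ countFiber d s, τ k - α * (countFiber d s).card) (fun q hq => ?_) s)
  have hw := hasSum_prod_apply (fun a => mul_nonneg (sub_pos.2 hq.2).le (pow_nonneg hq.1.le a))
    (hasSum_geometric_prob hq) d
  have hw0 : ∀ k : Fin d → ℕ, 0 ≤ ∏ j, (1 - q) * q ^ k j := fun k =>
    Finset.prod_nonneg fun j _ => mul_nonneg (sub_pos.2 hq.2).le (pow_nonneg hq.1.le _)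
  have hτ : Summable fun k => (∏ j, (1 - q) * q ^ k j) * τ k :=
    Summable.of_nonneg_of_le (fun k => mul_nonneg (hw0 k) (h0 k))
      (fun k => mul_le_of_le_one_right (hw0 k) (h1 k)) hw.summable
  have hτ' := hτ.hasSum
  rw [h q hq] at hτ'
  have h2 := hτ'.sub (hw.mul_right α)
  rw [one_mul, sub_self] at h2
  have h3 := (hasSum_countFiber h2).mul_left ((1 - q) ^ d)⁻¹
  rw [mul_zero] at h3
  refine h3.congr_fun fun s => ?_
  have hq1 : (1 - q) ^ d ≠ 0 := pow_ne_zero _ (sub_pos.2 hq.2).ne'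
  have e : ∀ k ∈ countFiber d s, (∏ j, (1 - q) * q ^ k j) * τ k - (∏ j, (1 - q) * q ^ k j) * α =
      (1 - q) ^ d * q ^ s * (τ k - α) := fun k hk => by
    rw [Finset.prod_mul_distrib, Finset.prod_const, Finset.prod_pow_eq_pow_sum,
      mem_countFiber.1 hk, Finset.card_univ, Fintype.card_fin, mul_sub]
  rw [Finset.sum_congr rfl e, ← Finset.mul_sum, Finset.sum_sub_distrib, Finset.sum_const,
    nsmul_eq_mul, mul_assoc, inv_mul_cancel_left₀ hq1, mul_comm α]

/-! ### The multi-mode family -/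

theorem gaussianState_zero_apply {N : ℝ} (hN : 0 < N) (χ : Fock ℕ) (a : ℕ) :
    gaussianState 0 N χ a = (((1 - thermalRatio N) * thermalRatio N ^ a : ℝ) : ℂ) * χ a := by
  have h := hasSum_gaussianState_apply hN 0 χ a
  refine h.unique ?_
  have h2 := hasSum_single (f := fun l => gaussianMatrix 0 N a l * χ l) a fun l hl => by
    rw [gaussianMatrix_zero hN, if_neg hl.symm, zero_mul]
  rwa [gaussianMatrix_zero hN a a, if_pos rfl] at h2

theorem ampliation_apply {m : ℕ} (j : Fin m) (A : Op ℕ) (ψ : Fock (Fin m → ℕ)) (k : Fin m → ℕ) :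
    ampliation j A ψ k = A (fiber j k ψ) (k j) := rfl

/-- Thermal factors are diagonal, so they only multiply coefficients. The list of modes `J` is
arbitrary so that the induction can discard its head. -/
theorem prod_ampliation_gaussianState_zero_apply {N : ℝ} (hN : 0 < N) {m d : ℕ}
    (J : Fin d → Fin m) (ψ : Fock (Fin m → ℕ)) (k : Fin m → ℕ) :
    (List.ofFn fun i => ampliation (J i) (gaussianState 0 N)).prod ψ k =
      ((∏ i, (1 - thermalRatio N) * thermalRatio N ^ k (J i) : ℝ) : ℂ) * ψ k := by
  induction d with
  | zero => simp
  | succ d ih =>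
    rw [List.ofFn_succ, List.prod_cons, mul_apply_eq_comp, ampliation_apply,
      gaussianState_zero_apply hN, fiber_apply, Function.update_eq_self, ih fun i => J i.succ,
      Fin.prod_univ_succ, Complex.ofReal_mul (_ * _), mul_assoc (Complex.ofReal _)]

/-- The probability of the photon numbers `k₁, …, k_n` in the thermal modes. -/
def thermalWeight {n : ℕ} (N : ℝ) (k : Fin (n + 1) → ℕ) : ℝ :=
  ∏ i : Fin n, (1 - thermalRatio N) * thermalRatio N ^ k i.succ

theorem thermalWeight_update {n : ℕ} (N : ℝ) (k : Fin (n + 1) → ℕ) (l : ℕ) :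
    thermalWeight N (Function.update k 0 l) = thermalWeight N k := by
  simp [thermalWeight]

theorem thermalProb_nonneg {N : ℝ} (hN : 0 < N) (a : ℕ) :
    0 ≤ (1 - thermalRatio N) * thermalRatio N ^ a :=
  mul_nonneg (sub_pos.2 (thermalRatio_lt_one hN)).le (pow_nonneg (thermalRatio_pos hN).le a)

theorem thermalWeight_nonneg {n : ℕ} {N : ℝ} (hN : 0 < N) (k : Fin (n + 1) → ℕ) :
    0 ≤ thermalWeight N k :=
  Finset.prod_nonneg fun _ _ => thermalProb_nonneg hN _

theorem hasSum_tFamily_apply {n : ℕ} (r : ℝ≥0) (ξ : Circle × Set.Ioi (0 : ℝ))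
    (χ : Fock (Fin (n + 1) → ℕ)) (k : Fin (n + 1) → ℕ) :
    HasSum (fun l => (ξ.1 : ℂ) ^ k 0 * conj (ξ.1 : ℂ) ^ l * ((thermalWeight ξ.2 k : ℂ) *
      gaussianMatrix (r : ℝ) ξ.2 (k 0) l * χ (Function.update k 0 l))) (tFamily n r ξ χ k) := by
  have hN : 0 < (ξ.2 : ℝ) := ξ.2.2
  rw [tFamily, tensorOp, List.ofFn_succ, List.prod_cons, mul_apply_eq_comp,
    ampliation_apply, Fin.cons_zero]
  simp only [Fin.cons_succ]
  refine (hasSum_gaussianState_apply hN _ _ _).congr_fun fun l => ?_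
  rw [fiber_apply, prod_ampliation_gaussianState_zero_apply hN,
    mul_comm ((r : ℝ) : ℂ) (ξ.1 : ℂ), gaussianMatrix_circle_mul]
  have := thermalWeight_update (ξ.2 : ℝ) k l
  simp only [thermalWeight] at this
  rw [this, thermalWeight]
  ring

/-! ### The trace of `ρT` as an absolutely convergent series -/

theorem rejectProb_eq {ι : Type*} [DecidableEq ι] (ρ T : Op ι) :
    rejectProb ρ T = (∑' k, ρ (T (ket k)) k).re := by
  rw [rejectProb, trace]
  congr 2
  funext k
  rw [ket, lp.inner_single_left]
  simp

theorem norm_ket {ι : Type*} [DecidableEq ι] (i : ι) : ‖(ket i : Fock ι)‖ = 1 := by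
  rw [ket, lp.norm_single (by norm_num), norm_one]

theorem norm_apply_ket_le {ι : Type*} [DecidableEq ι] (T : Op ι) (i j : ι) :
    ‖T (ket i) j‖ ≤ ‖T‖ := by
  refine (lp.norm_apply_le_norm (by norm_num) _ j).trans ?_
  simpa [norm_ket] using T.le_opNorm (ket i)

/-- The summands of the trace of `ρ T` for the family of the `t` test, at phase `1`. -/
def traceTerm {n : ℕ} (r N : ℝ) (T : Op (Fin (n + 1) → ℕ)) (p : (Fin (n + 1) → ℕ) × ℕ) : ℂ :=
  (thermalWeight N p.1 : ℂ) * gaussianMatrix r N (p.1 0) p.2 *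
    T (ket p.1) (Function.update p.1 0 p.2)

theorem hasSum_thermalWeight_mul {n : ℕ} {N : ℝ} (hN : 0 < N) {f : ℕ → ℝ} (hf : ∀ a, 0 ≤ f a)
    {x : ℝ} (h : HasSum f x) :
    HasSum (fun k : Fin (n + 1) → ℕ => thermalWeight N k * f (k 0)) x := by
  have hB := hasSum_prod_apply (thermalProb_nonneg hN)
    (hasSum_geometric_prob ⟨thermalRatio_pos hN, thermalRatio_lt_one hN⟩) n
  have hs := h.summable.mul_of_nonneg hB.summable hf
    fun k => Finset.prod_nonneg fun j _ => thermalProb_nonneg hN _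
  have h2 := h.mul hB hs
  rw [mul_one] at h2
  rw [← (Fin.consEquiv fun _ => ℕ).hasSum_iff]
  refine h2.congr_fun fun p => ?_
  simp [thermalWeight, Fin.consEquiv, mul_comm]

/-- The entries of `T` are merely bounded by `‖T‖`, so convergence comes from the state: geometric
decay of the Gaussian matrix in both indices, and the thermal weights. -/
theorem summable_norm_traceTerm {n : ℕ} {N : ℝ} (hN : 0 < N) (r : ℝ)
    (T : Op (Fin (n + 1) → ℕ)) : Summable fun p => ‖traceTerm r N T p‖ := by
  obtain ⟨C, v, hC, hv0, hv1, hb⟩ := exists_norm_gaussianMatrix_le hN (r : ℂ)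
  have hg := hasSum_geometric_of_lt_one hv0.le hv1
  have h1 := hasSum_thermalWeight_mul (n := n) hN (fun a => pow_nonneg hv0.le a) hg
  have h2 := (h1.summable.mul_of_nonneg hg.summable
    (fun k => mul_nonneg (thermalWeight_nonneg hN k) (pow_nonneg hv0.le _))
    (fun a => pow_nonneg hv0.le a)).mul_left (C * ‖T‖)
  refine Summable.of_nonneg_of_le (fun p => norm_nonneg _) (fun p => ?_) h2
  have hw := thermalWeight_nonneg hN p.1
  rw [traceTerm, norm_mul, norm_mul, Complex.norm_real, Real.norm_of_nonneg hw]
  calc _ ≤ thermalWeight N p.1 * (C * (v ^ p.1 0 * v ^ p.2)) * ‖T‖ := by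
        gcongr
        exacts [hb _ _, norm_apply_ket_le T _ _]
    _ = _ := by ring

theorem norm_phase_mul (w : Circle) (a l : ℕ) (z : ℂ) :
    ‖(w : ℂ) ^ a * conj (w : ℂ) ^ l * z‖ = ‖z‖ := by
  rw [norm_mul, norm_mul, norm_pow, norm_pow, RCLike.norm_conj, Circle.norm_coe]
  simp

/-- The phase enters only through unimodular factors, so the absolute bound is uniform in it and the
series can be integrated over the circle. -/
theorem hasSum_trace {n : ℕ} (r : ℝ≥0) (ξ : Circle × Set.Ioi (0 : ℝ))
    (T : Op (Fin (n + 1) → ℕ)) :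
    HasSum (fun p : (Fin (n + 1) → ℕ) × ℕ => (ξ.1 : ℂ) ^ p.1 0 * conj (ξ.1 : ℂ) ^ p.2 *
      traceTerm r ξ.2 T p) (∑' k, tFamily n r ξ (T (ket k)) k) := by
  have hs : Summable fun p : (Fin (n + 1) → ℕ) × ℕ =>
      (ξ.1 : ℂ) ^ p.1 0 * conj (ξ.1 : ℂ) ^ p.2 * traceTerm r ξ.2 T p := by
    refine Summable.of_norm ?_
    simp only [norm_phase_mul]
    exact summable_norm_traceTerm ξ.2.2 r T
  have h := hs.hasSum
  rw [hs.tsum_prod] at h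
  convert h using 1
  refine tsum_congr fun k => ((hasSum_tFamily_apply r ξ (T (ket k)) k).tsum_eq).symm

/-- The rejection probability averaged over the phase. -/
def meanReject {n : ℕ} (r N : ℝ) (τ : (Fin (n + 1) → ℕ) → ℝ) : ℝ :=
  ∑' k, thermalWeight N k * photonProb r N (k 0) * τ k

/-- The diagonal of an operator in the number basis. -/
def diagEntry {ι : Type*} [DecidableEq ι] (T : Op ι) (k : ι) : ℝ := (T (ket k) k).re

theorem traceTerm_self {n : ℕ} {N : ℝ} (hN : 0 < N) (r : ℝ) (T : Op (Fin (n + 1) → ℕ))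
    (k : Fin (n + 1) → ℕ) : traceTerm r N T (k, k 0) =
      ((thermalWeight N k * photonProb r N (k 0) : ℝ) : ℂ) * T (ket k) k := by
  rw [traceTerm, Function.update_eq_self, gaussianMatrix_self hN, Complex.ofReal_mul]

theorem re_tsum_traceTerm_self {n : ℕ} {N : ℝ} (hN : 0 < N) (r : ℝ) (T : Op (Fin (n + 1) → ℕ)) :
    (∑' k, traceTerm r N T (k, k 0)).re = meanReject r N (diagEntry T) := by
  have hinj : Function.Injective fun k : Fin (n + 1) → ℕ => (k, k 0) :=
    fun i j hij => congrArg Prod.fst hij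
  have hs : Summable fun k => traceTerm r N T (k, k 0) :=
    ((summable_norm_traceTerm hN r T).comp_injective hinj).of_norm
  rw [Complex.re_tsum hs]
  refine tsum_congr fun k => ?_
  rw [traceTerm_self hN, Complex.re_ofReal_mul, diagEntry]

/-! ### Averaging over the phase -/

theorem setIntegral_phase (a l : ℕ) :
    ∫ t in Set.Ioc 0 (2 * Real.pi), (Circle.exp t : ℂ) ^ a * conj (Circle.exp t : ℂ) ^ l =
      if a = l then ((2 * Real.pi : ℝ) : ℂ) else 0 := by
  rw [← intervalIntegral.integral_of_le Real.two_pi_pos.le]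
  have e : ∀ t : ℝ, (Circle.exp t : ℂ) ^ a * conj (Circle.exp t : ℂ) ^ l =
      Complex.exp ((((a : ℂ) - l) * Complex.I) * t) := fun t => by
    rw [circle_exp_pow_mul_conj_pow]
    ring_nf
  simp only [e]
  split_ifs with h
  · simp [h]
  · have hne : (a : ℂ) - l ≠ 0 := sub_ne_zero.2 (by exact_mod_cast h)
    rw [integral_exp_mul_complex (mul_ne_zero hne Complex.I_ne_zero)]
    have h1 : Complex.exp ((((a : ℂ) - l) * Complex.I) * ((2 * Real.pi : ℝ) : ℂ)) = 1 := by
      rw [Complex.exp_eq_one_iff]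
      refine ⟨(a : ℤ) - l, ?_⟩
      push_cast
      ring
    rw [h1]
    simp

theorem continuous_coe_circle_exp : Continuous fun t : ℝ => (Circle.exp t : ℂ) := by
  simp only [Circle.coe_exp]
  fun_prop

/-- Integrating over the phase keeps only the terms with `k₀ = l`, so the right side is the average
of the left, and a function is somewhere at most its average. The parameter `N` stays fixed. -/
theorem exists_rejectProb_le_meanReject {n : ℕ} (r : ℝ≥0) (N : Set.Ioi (0 : ℝ))
    (T : Op (Fin (n + 1) → ℕ)) :
    ∃ w : Circle, rejectProb (tFamily n r (w, N)) T ≤ meanReject r N (diagEntry T) := by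
  have hN : 0 < (N : ℝ) := N.2
  set f : ℝ → ℂ := fun t => ∑' k, tFamily n r (Circle.exp t, N) (T (ket k)) k with hf
  set F : (Fin (n + 1) → ℕ) × ℕ → ℝ → ℂ := fun p t => (Circle.exp t : ℂ) ^ p.1 0 *
    conj (Circle.exp t : ℂ) ^ p.2 * traceTerm r N T p with hF
  have hsum : ∀ t, HasSum (fun p => F p t) (f t) := fun t => hasSum_trace r (Circle.exp t, N) T
  have hFc : ∀ p, Continuous (F p) := fun p =>
    ((continuous_coe_circle_exp.pow _).mul
      ((Complex.continuous_conj.comp continuous_coe_circle_exp).pow _)).mul continuous_const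
  have hFn : ∀ p t, ‖F p t‖ = ‖traceTerm r N T p‖ := fun p t => norm_phase_mul _ _ _ _
  have hnorm := summable_norm_traceTerm hN r T
  have hfc : Continuous f := by
    have h := continuous_tsum hFc hnorm fun p t => (hFn p t).le
    exact h.congr fun t => (hsum t).tsum_eq
  have hfi : IntegrableOn f (Set.Ioc 0 (2 * Real.pi)) := hfc.integrableOn_Ioc
  have hint := hasSum_integral_of_dominated_convergence
    (μ := volume.restrict (Set.Ioc 0 (2 * Real.pi))) (F := F) (f := f)
    (fun p _ => ‖traceTerm r N T p‖) (fun p => (hFc p).aestronglyMeasurable)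
    (fun p => Eventually.of_forall fun t => (hFn p t).le)
    (Eventually.of_forall fun _ => hnorm) (integrable_const _) (Eventually.of_forall hsum)
  have hint2 : HasSum (fun p : (Fin (n + 1) → ℕ) × ℕ =>
      (if p.1 0 = p.2 then ((2 * Real.pi : ℝ) : ℂ) else 0) * traceTerm r N T p)
      (∫ t in Set.Ioc 0 (2 * Real.pi), f t) := by
    refine hint.congr_fun fun p => ?_
    rw [hF, integral_mul_const, setIntegral_phase]
  have hinj : Function.Injective fun k : Fin (n + 1) → ℕ => (k, k 0) :=
    fun i j hij => congrArg Prod.fst hij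
  rw [← hinj.hasSum_iff] at hint2
  swap
  · rintro ⟨k, l⟩ hk
    rw [if_neg fun h => hk ⟨k, Prod.ext rfl h⟩, zero_mul]
  have hval : ∫ t in Set.Ioc 0 (2 * Real.pi), (f t).re =
      2 * Real.pi * meanReject r N (diagEntry T) := by
    have h1 := Complex.reCLM.integral_comp_comm hfi
    simp only [Complex.reCLM_apply] at h1
    rw [h1, ← hint2.tsum_eq, ← re_tsum_traceTerm_self hN, ← Complex.re_ofReal_mul, ← tsum_mul_left]
    simp
  obtain ⟨t, -, ht⟩ := exists_le_setAverage (μ := volume) (s := Set.Ioc 0 (2 * Real.pi))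
    (f := fun t => (f t).re) (by simp [Real.pi_pos]) measure_Ioc_lt_top.ne hfi.re
  refine ⟨Circle.exp t, ?_⟩
  rw [rejectProb_eq]
  refine ht.trans (le_of_eq ?_)
  rw [setAverage_eq, hval, Measure.real, Real.volume_Ioc, sub_zero,
    ENNReal.toReal_ofReal Real.two_pi_pos.le, smul_eq_mul, inv_mul_cancel_left₀]
  positivity

/-- No averaging is needed when the off-diagonal terms vanish by themselves. This covers `r = 0`,
where the state is diagonal, and diagonal tests. -/
theorem rejectProb_eq_meanReject {n : ℕ} (r : ℝ≥0) (ξ : Circle × Set.Ioi (0 : ℝ))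
    (T : Op (Fin (n + 1) → ℕ)) (h : ∀ (k : Fin (n + 1) → ℕ) (l : ℕ), k 0 ≠ l →
      gaussianMatrix (r : ℝ) ξ.2 (k 0) l = 0 ∨ T (ket k) (Function.update k 0 l) = 0) :
    rejectProb (tFamily n r ξ) T = meanReject r ξ.2 (diagEntry T) := by
  have hs := hasSum_trace r ξ T
  have hinj : Function.Injective fun k : Fin (n + 1) → ℕ => (k, k 0) :=
    fun i j hij => congrArg Prod.fst hij
  rw [← hinj.hasSum_iff] at hs
  swap
  · rintro ⟨k, l⟩ hk
    have hkl : k 0 ≠ l := fun h => hk ⟨k, Prod.ext rfl h⟩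
    rcases h k l hkl with h | h <;> simp [traceTerm, h]
  rw [rejectProb_eq, ← hs.tsum_eq, ← re_tsum_traceTerm_self ξ.2.2]
  congr 2
  funext k
  simp only [Function.comp]
  rw [← mul_pow, Complex.mul_conj, Circle.normSq_coe]
  simp

theorem rejectProb_tFamily_zero {n : ℕ} (ξ : Circle × Set.Ioi (0 : ℝ))
    (T : Op (Fin (n + 1) → ℕ)) :
    rejectProb (tFamily n 0 ξ) T = meanReject 0 ξ.2 (diagEntry T) := by
  refine rejectProb_eq_meanReject 0 ξ T fun k l hkl => Or.inl ?_
  rw [NNReal.coe_zero, Complex.ofReal_zero, gaussianMatrix_zero ξ.2.2, if_neg hkl]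

theorem diagOp_ket_apply {ι : Type*} [DecidableEq ι] (φ : ι → unitInterval) (k i : ι) :
    diagOp φ (ket k) i = if i = k then ((φ k : ℝ) : ℂ) else 0 := by
  have h : diagOp φ (ket k) i = ((φ i : ℝ) : ℂ) * ket k i := rfl
  rw [h, ket, lp.single_apply]
  by_cases hik : i = k
  · subst hik
    simp
  · simp [hik]

theorem rejectProb_diagOp {n : ℕ} (r : ℝ≥0) (ξ : Circle × Set.Ioi (0 : ℝ))
    (φ : (Fin (n + 1) → ℕ) → unitInterval) :
    rejectProb (tFamily n r ξ) (diagOp φ) = meanReject r ξ.2 fun k => (φ k : ℝ) := by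
  rw [rejectProb_eq_meanReject r ξ]
  · congr 1
    funext k
    simp [diagEntry, diagOp_ket_apply]
  · intro k l hkl
    right
    rw [diagOp_ket_apply, if_neg]
    intro h
    exact hkl (by rw [← h, Function.update_self])

/-! ### Tests -/

theorem diagEntry_nonneg {ι : Type*} [DecidableEq ι] {T : Op ι} (hT : 0 ≤ T) (k : ι) :
    0 ≤ diagEntry T k := by
  have h := ((ContinuousLinearMap.nonneg_iff_isPositive T).1 hT).re_inner_nonneg_right (ket k)
  rw [ket, lp.inner_single_left] at h
  simpa [diagEntry, ket] using h

theorem diagEntry_le_one {ι : Type*} [DecidableEq ι] {T : Op ι} (hT : T ≤ 1) (k : ι) :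
    diagEntry T k ≤ 1 := by
  have h := diagEntry_nonneg (sub_nonneg.2 hT) k
  have h2 : diagEntry (1 - T) k = 1 - diagEntry T k := by
    simp [diagEntry, ket]
  rw [h2] at h
  exact sub_nonneg.1 h

theorem diagOp_nonneg {ι : Type*} (φ : ι → unitInterval) : 0 ≤ diagOp φ := by
  rw [ContinuousLinearMap.nonneg_iff_isPositive, ContinuousLinearMap.isPositive_iff_complex]
  intro ψ
  have h : ⟪diagOp φ ψ, ψ⟫_ℂ = ((∑' i, (φ i : ℝ) * ‖ψ i‖ ^ 2 : ℝ) : ℂ) := by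
    rw [lp.inner_eq_tsum, Complex.ofReal_tsum]
    refine tsum_congr fun i => ?_
    have h1 : diagOp φ ψ i = ((φ i : ℝ) : ℂ) * ψ i := rfl
    rw [h1, RCLike.inner_apply, map_mul, Complex.conj_ofReal, mul_left_comm, Complex.mul_conj,
      Complex.normSq_eq_norm_sq, Complex.ofReal_mul]
  rw [h]
  exact ⟨by simp, by
    simpa using tsum_nonneg fun i => mul_nonneg (φ i).2.1 (sq_nonneg ‖ψ i‖)⟩

theorem isTest_diagOp {ι : Type*} (φ : ι → unitInterval) : IsTest (diagOp φ) := by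
  refine ⟨diagOp_nonneg φ, sub_nonneg.1 ?_⟩
  have h : 1 - diagOp φ = diagOp fun i => unitInterval.symm (φ i) := by
    ext ψ i
    have h1 : ∀ φ : ι → unitInterval, diagOp φ ψ i = ((φ i : ℝ) : ℂ) * ψ i := fun _ => rfl
    have h2 : (1 - diagOp φ) ψ i = ψ i - diagOp φ ψ i := rfl
    rw [h2, h1, h1, unitInterval.coe_symm_eq]
    push_cast
    ring
  rw [h]
  exact diagOp_nonneg _

/-! ### The mean rejection probability -/

theorem photonProb_zero {N : ℝ} (hN : 0 < N) (a : ℕ) :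
    photonProb 0 N a = (1 - thermalRatio N) * thermalRatio N ^ a := by
  rw [photonProb, Complex.ofReal_zero, gaussianMatrix_zero hN, if_pos rfl, Complex.ofReal_re]

theorem likelihoodRatio_zero {N : ℝ} (hN : 0 < N) (a : ℕ) : likelihoodRatio 0 N a = 1 := by
  have h := photonProb_eq hN 0 a
  rw [photonProb_zero hN] at h
  have hne : (1 - thermalRatio N) * thermalRatio N ^ a ≠ 0 :=
    mul_ne_zero (sub_pos.2 (thermalRatio_lt_one hN)).ne' (pow_ne_zero _ (thermalRatio_pos hN).ne')
  exact (mul_eq_left₀ hne).1 h.symm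

/-- On a fiber the weight is a constant times the likelihood ratio of `k₀`. Comparing tests thus
reduces to comparing them fiber by fiber. -/
theorem thermalWeight_mul_photonProb {n : ℕ} {N : ℝ} (hN : 0 < N) (r : ℝ) {s : ℕ}
    {k : Fin (n + 1) → ℕ} (hk : k ∈ countFiber (n + 1) s) :
    thermalWeight N k * photonProb r N (k 0) =
      (1 - thermalRatio N) ^ (n + 1) * thermalRatio N ^ s * likelihoodRatio r N (k 0) := by
  rw [photonProb_eq hN, ← mul_assoc, mul_comm (thermalWeight N k), thermalWeight,
    ← Fin.prod_univ_succ fun j => (1 - thermalRatio N) * thermalRatio N ^ k j,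
    Finset.prod_mul_distrib, Finset.prod_const, Finset.prod_pow_eq_pow_sum, mem_countFiber.1 hk,
    Finset.card_univ, Fintype.card_fin]

theorem hasSum_weight {n : ℕ} {N : ℝ} (hN : 0 < N) (r : ℝ) :
    HasSum (fun k : Fin (n + 1) → ℕ => thermalWeight N k * photonProb r N (k 0)) 1 :=
  hasSum_thermalWeight_mul hN (photonProb_nonneg hN r) (hasSum_photonProb hN r)

theorem weight_nonneg {n : ℕ} {N : ℝ} (hN : 0 < N) (r : ℝ) (k : Fin (n + 1) → ℕ) :
    0 ≤ thermalWeight N k * photonProb r N (k 0) :=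
  mul_nonneg (thermalWeight_nonneg hN k) (photonProb_nonneg hN r _)

theorem hasSum_meanReject {n : ℕ} {N : ℝ} (hN : 0 < N) (r : ℝ) {τ : (Fin (n + 1) → ℕ) → ℝ}
    (h0 : ∀ k, 0 ≤ τ k) (h1 : ∀ k, τ k ≤ 1) :
    HasSum (fun k => thermalWeight N k * photonProb r N (k 0) * τ k) (meanReject r N τ) :=
  (Summable.of_nonneg_of_le (fun k => mul_nonneg (weight_nonneg hN r k) (h0 k))
    (fun k => mul_le_of_le_one_right (weight_nonneg hN r k) (h1 k))
    (hasSum_weight hN r).summable).hasSum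

theorem meanReject_const {n : ℕ} {N : ℝ} (hN : 0 < N) (r α : ℝ) :
    meanReject r N (fun _ : Fin (n + 1) → ℕ => α) = α := by
  have h := ((hasSum_weight (n := n) hN r).mul_right α).tsum_eq
  rwa [one_mul] at h

theorem meanReject_le_of_fiber {n : ℕ} {N : ℝ} (hN : 0 < N) (r : ℝ)
    {τ σ : (Fin (n + 1) → ℕ) → ℝ} (hτ0 : ∀ k, 0 ≤ τ k) (hτ1 : ∀ k, τ k ≤ 1)
    (hσ0 : ∀ k, 0 ≤ σ k) (hσ1 : ∀ k, σ k ≤ 1)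
    (h : ∀ s, ∑ k ∈ countFiber (n + 1) s, likelihoodRatio r N (k 0) * τ k ≤
      ∑ k ∈ countFiber (n + 1) s, likelihoodRatio r N (k 0) * σ k) :
    meanReject r N τ ≤ meanReject r N σ := by
  refine hasSum_le (fun s => ?_) (hasSum_countFiber (hasSum_meanReject hN r hτ0 hτ1))
    (hasSum_countFiber (hasSum_meanReject hN r hσ0 hσ1))
  have e : ∀ ρ : (Fin (n + 1) → ℕ) → ℝ, ∑ k ∈ countFiber (n + 1) s,
      thermalWeight N k * photonProb r N (k 0) * ρ k =
      (1 - thermalRatio N) ^ (n + 1) * thermalRatio N ^ s *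
        ∑ k ∈ countFiber (n + 1) s, likelihoodRatio r N (k 0) * ρ k := fun ρ => by
    rw [Finset.mul_sum]
    exact Finset.sum_congr rfl fun k hk => by
      rw [thermalWeight_mul_photonProb hN r hk, mul_assoc]
  rw [e, e]
  exact mul_le_mul_of_nonneg_left (h s) (mul_nonneg
    (pow_nonneg (sub_pos.2 (thermalRatio_lt_one hN)).le _) (pow_nonneg (thermalRatio_pos hN).le _))

/-- A lower bound for the mean error probability, used to let `r → 0`. -/
theorem exp_mul_le_one_sub_meanReject {n : ℕ} {N : ℝ} (hN : 0 < N) (r : ℝ)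
    {τ : (Fin (n + 1) → ℕ) → ℝ} (h0 : ∀ k, 0 ≤ τ k) (h1 : ∀ k, τ k ≤ 1) :
    Real.exp (-r ^ 2 / N) * (1 - meanReject 0 N τ) ≤ 1 - meanReject r N τ := by
  refine hasSum_le (fun k => ?_)
    (((hasSum_weight hN 0).sub (hasSum_meanReject hN 0 h0 h1)).mul_left _)
    ((hasSum_weight hN r).sub (hasSum_meanReject hN r h0 h1))
  have hp : Real.exp (-r ^ 2 / N) * photonProb 0 N (k 0) ≤ photonProb r N (k 0) := by
    rw [photonProb_zero hN, photonProb_eq hN, mul_comm]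
    exact mul_le_mul_of_nonneg_left (exp_le_likelihoodRatio hN r _) (thermalProb_nonneg hN _)
  have h2 := mul_le_mul_of_nonneg_left hp
    (mul_nonneg (thermalWeight_nonneg hN k) (sub_nonneg.2 (h1 k)))
  calc _ = thermalWeight N k * (1 - τ k) * (Real.exp (-r ^ 2 / N) * photonProb 0 N (k 0)) := by
        ring
    _ ≤ _ := h2
    _ = _ := by ring

/-- The level gives `≤`. For `≥`, unbiasedness at a favourable phase bounds the mean error by `1 -
α` for each `r > 0`; the lower bound for that error passes to the limit `r → 0`. -/
theorem meanReject_zero_of_isUnbiased {n : ℕ} {α : ℝ} {T : Op (Fin (n + 1) → ℕ)}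
    (hT : IsUnbiased (tFamily n) {0} (Set.Ioi 0) α T) {N : ℝ} (hN : 0 < N) :
    meanReject 0 N (diagEntry T) = α := by
  obtain ⟨⟨⟨hT0, hT1⟩, hlevel⟩, hunb⟩ := hT
  refine le_antisymm ?_ ?_
  · have h := hlevel 0 rfl (1, ⟨N, hN⟩)
    rwa [rejectProb_tFamily_zero] at h
  · have hr : ∀ r : ℝ, 0 < r →
        Real.exp (-r ^ 2 / N) * (1 - meanReject 0 N (diagEntry T)) ≤ 1 - α := by
      intro r hr
      refine (exp_mul_le_one_sub_meanReject hN r (diagEntry_nonneg hT0)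
        (diagEntry_le_one hT1)).trans ?_
      obtain ⟨w, hw⟩ := exists_rejectProb_le_meanReject ⟨r, hr.le⟩ ⟨N, hN⟩ T
      have h := hunb ⟨r, hr.le⟩ hr (w, ⟨N, hN⟩)
      rw [typeIIError] at h
      change _ ≤ meanReject r N (diagEntry T) at hw
      linarith
    have hc : Continuous fun r : ℝ =>
        Real.exp (-r ^ 2 / N) * (1 - meanReject 0 N (diagEntry T)) := by fun_prop
    have hlim := (hc.tendsto 0).mono_left (nhdsWithin_le_nhds (s := Set.Ioi 0))
    have h := le_of_tendsto hlim (eventually_nhdsWithin_of_forall hr)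
    norm_num at h
    linarith

theorem sum_diagEntry_of_isUnbiased {n : ℕ} {α : ℝ} {T : Op (Fin (n + 1) → ℕ)}
    (hT : IsUnbiased (tFamily n) {0} (Set.Ioi 0) α T) (s : ℕ) :
    ∑ k ∈ countFiber (n + 1) s, diagEntry T k = α * ((s + n).choose n : ℝ) := by
  have h := sum_countFiber_eq_of_tsum_eq (diagEntry_nonneg hT.1.1.1) (diagEntry_le_one hT.1.1.2)
    (α := α) (fun q hq => ?_) s
  · rwa [card_countFiber (by omega), ← add_assoc, Nat.add_sub_cancel, Nat.add_sub_cancel] at h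
  · have hq1 : 0 < 1 - q := sub_pos.2 hq.2
    -- This `N` inverts `thermalRatio`, so every `q` in `(0, 1)` occurs.
    have hN : 0 < q / (1 - q) := div_pos hq.1 hq1
    have hqN : thermalRatio (q / (1 - q)) = q := by
      unfold thermalRatio
      field_simp
      ring
    rw [← meanReject_zero_of_isUnbiased hT hN, meanReject]
    refine tsum_congr fun k => ?_
    rw [photonProb_zero hN, thermalWeight, hqN, Fin.prod_univ_succ, mul_comm ((1 - q) * _)]

/-! ### Unbiasedness and optimality of the `t` test -/

theorem isUnbiased_tTest {n : ℕ} (hn : 1 ≤ n) {α : ℝ} (hα : α ∈ Set.Ioo (0 : ℝ) 1) {c : ℕ → ℕ}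
    {γ : ℕ → Set.Ioc (0 : ℝ) 1} (h : IsTThreshold n α c γ) :
    IsUnbiased (tFamily n) {0} (Set.Ioi 0) α (tTest n c γ) := by
  -- The constant test `α` has the same fiber sums and rejects with probability `α` everywhere. The
  -- `t` test ties with it at `r = 0` and does at least as well for `r > 0`.
  have hs : ∀ s, ∑ _k ∈ countFiber (n + 1) s, α =
      ∑ k ∈ countFiber (n + 1) s, (tTestFun c γ k : ℝ) := fun s => by
    rw [sum_tTestFun hn hα h, Finset.sum_const, card_countFiber (by omega), nsmul_eq_mul, mul_comm]
    rfl
  refine ⟨⟨isTest_diagOp _, ?_⟩, ?_⟩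
  · rintro _ rfl ξ
    rw [tTest, rejectProb_diagOp]
    calc _ ≤ meanReject 0 ξ.2 (fun _ : Fin (n + 1) → ℕ => α) := by
          refine meanReject_le_of_fiber ξ.2.2 0 (fun k => (tTestFun c γ k).2.1)
            (fun k => (tTestFun c γ k).2.2) (fun _ => hα.1.le) (fun _ => hα.2.le) fun s => ?_
          simp only [likelihoodRatio_zero ξ.2.2, one_mul, hs, le_refl]
      _ = α := meanReject_const ξ.2.2 0 α
  · intro r _ ξ
    rw [typeIIError, tTest, rejectProb_diagOp, sub_le_sub_iff_left]
    calc α = meanReject r ξ.2 (fun _ : Fin (n + 1) → ℕ => α) := (meanReject_const ξ.2.2 _ α).symm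
      _ ≤ _ := meanReject_le_of_fiber ξ.2.2 r (fun _ => hα.1.le) (fun _ => hα.2.le)
          (fun k => (tTestFun c γ k).2.1) (fun k => (tTestFun c γ k).2.2) fun s =>
          sum_mul_le_sum_mul_tTestFun (likelihoodRatio_monotone ξ.2.2 r) (fun _ => hα.1.le)
            (fun _ => hα.2.le) s (hs s)

/-- For each `N` the error of the `t` test is the same at all phases, and the competitor does no
better at some phase `w` for the same `N`. Both tests have equal fiber sums, so the fiberwise
comparison applies. -/
theorem worstTypeIIError_tTest_le {n : ℕ} (hn : 1 ≤ n) {α : ℝ} (hα : α ∈ Set.Ioo (0 : ℝ) 1)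
    {c : ℕ → ℕ} {γ : ℕ → Set.Ioc (0 : ℝ) 1} (h : IsTThreshold n α c γ) (r : ℝ≥0)
    {T : Op (Fin (n + 1) → ℕ)} (hT : IsUnbiased (tFamily n) {0} (Set.Ioi 0) α T) :
    worstTypeIIError (tFamily n) r (tTest n c γ) ≤ worstTypeIIError (tFamily n) r T := by
  refine iSup_le fun ξ => ?_
  obtain ⟨w, hw⟩ := exists_rejectProb_le_meanReject r ξ.2 T
  refine le_trans ?_ (le_iSup (fun ξ => (typeIIError (tFamily n r ξ) T : EReal)) (w, ξ.2))
  rw [EReal.coe_le_coe_iff, typeIIError, typeIIError, sub_le_sub_iff_left, tTest,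
    rejectProb_diagOp]
  have h0 := diagEntry_nonneg hT.1.1.1
  have h1 := diagEntry_le_one hT.1.1.2
  refine hw.trans (meanReject_le_of_fiber ξ.2.2 r h0 h1
    (fun k => (tTestFun c γ k).2.1) (fun k => (tTestFun c γ k).2.2) fun s =>
    sum_mul_le_sum_mul_tTestFun (likelihoodRatio_monotone ξ.2.2 r) h0 h1 s ?_)
  rw [sum_diagEntry_of_isUnbiased hT, sum_tTestFun hn hα h]

end

end QuantumTest

theorem mainTheorem2 (n : ℕ) (hn : 1 ≤ n) (α : ℝ) (hα : α ∈ Set.Ioo (0 : ℝ) 1) :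
    (∃! p : (ℕ → ℕ) × (ℕ → Set.Ioc (0 : ℝ) 1), QuantumTest.IsTThreshold n α p.1 p.2) ∧
    ∀ (c : ℕ → ℕ) (γ : ℕ → Set.Ioc (0 : ℝ) 1), QuantumTest.IsTThreshold n α c γ →
      QuantumTest.IsUMPUnbiasedMinMax (QuantumTest.tFamily n) {0} (Set.Ioi 0) α
        (QuantumTest.tTest n c γ) := by
  refine ⟨QuantumTest.existsUnique_isTThreshold hn hα, fun c γ h => ?_⟩
  have hU := QuantumTest.isUnbiased_tTest hn hα h
  refine ⟨hU, fun r _ => le_antisymm ?_ (iInf₂_le _ hU)⟩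
  exact le_iInf₂ fun T hT => QuantumTest.worstTypeIIError_tTest_le hn hα h r hT
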